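/- An operator system is a real linear subspace $\mathcal M$ of the self-adjoint operators in $\mathcal B(\mathcal K)$, for some complex Hilbert space $\mathcal K$, that contains the identity $\mathbb 1$ (equivalently, the space of Hermitian elements of a complex adjoint-closed subspace of $\mathcal B(\mathcal K)$ containing $\mathbb 1$). It is ordered by the operator order. A representation of $\mathcal M$ on a Hilbert space $\mathcal H$ is a real-linear map $T:\mathcal M\to\mathcal B(\mathcal H)$ that is positive ($a\ge 0$ implies $T(a)\ge 0$) and unital ($T(\mathbb 1)=\mathbb 1$). Let $\mathcal M_A$ and $\mathcal M_B$ be operator systems and let $\mathcal M_A\otimes\mathcal M_B$ be their algebraic tensor product over $\mathbb R$. Two representations $T_A$ of $\mathcal M_A$ and $T_B$ of $\mathcal M_B$ on the same $\mathcal H$ have commuting ranges if $T_A(a)T_B(b)=T_B(b)T_A(a)$ for all $a,b$; then $T_A\cdot T_B$ denotes the linear map with $(T_A\cdot T_B)(a\otimes b)=T_A(a)T_B(b)$. For representations $T_A$ on $\mathcal H_A$ and $T_B$ on $\mathcal H_B$, $T_A\otimes T_B$ denotes the linear map into $\mathcal B(\mathcal H_A\otimes\mathcal H_B)$ with $a\otimes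 b\mapsto T_A(a)\otimes T_B(b)$. For $z\in\mathcal M_A\otimes\mathcal M_B$ put $$\|z\|_{pmax}=\sup\|(T_A\cdot T_B)(z)\|,\qquad \|z\|_{pmin}=\sup\|(T_A\otimes T_B)(z)\|,$$ where the first supremum is over all Hilbert spaces $\mathcal H$ and all pairs of representations on $\mathcal H$ with commuting ranges, and the second is over all Hilbert spaces $\mathcal H_A,\mathcal H_B$ and all representations on them. Call $z$ pmax-positive if $(T_A\cdot T_B)(z)\ge 0$ for all pairs of representations with commuting ranges. A state on $\mathcal M_A\otimes_{pmax}\mathcal M_B$ is a real-linear functional $\omega:\mathcal M_A\otimes\mathcal M_B\to\mathbb R$ that is nonnegative on pmax-positive elements and satisfies $\omega(\mathbb 1\otimes\mathbb 1)=1$. Then the following are equivalent. (i) $\|z\|_{pmin}=\|z\|_{pmax}$ for every $z\in\mathcal M_A\otimes\mathcal M_B$. (ii) For every $z\in\mathcal M_A\otimes\mathcal M_B$, every state $\omega$ on $\mathcal M_A\otimes_{pmax}\mathcal M_B$ and every $\varepsilon>0$ there are a finite-dimensional Hilbert space $\mathcal H_\varepsilon$, representations $T_A^\varepsilon$ of $\mathcal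 M_A$ and $T_B^\varepsilon$ of $\mathcal M_B$ on $\mathcal H_\varepsilon$ with commuting ranges, and a state $\omega_\varepsilon$ on $\mathcal B(\mathcal H_\varepsilon)$ such that $$|\omega(z)-\omega_\varepsilon((T_A^\varepsilon\cdot T_B^\varepsilon)(z))|<\varepsilon .$$ -/

import Mathlib

open scoped TensorProduct ComplexOrder

universe u

/-- An operator system, in the real form in which observables and outcome spaces are handled:
a real linear space of self-adjoint bounded operators on a Hilbert space `K` that contains the
identity. These are exactly the spaces of Hermitian elements of the complex, adjoint-closed
subspaces of `B(K)` containing the identity. The order is the operator order of `B(K)`. -/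
structure OperatorSystem (K : Type*) [NormedAddCommGroup K] [InnerProductSpace ℂ K]
    [CompleteSpace K] extends Submodule ℝ (K →L[ℂ] K) where
  isSelfAdjoint_of_mem' : ∀ a ∈ carrier, IsSelfAdjoint a
  one_mem' : (1 : K →L[ℂ] K) ∈ carrier

namespace OperatorSystem

section Basic

variable {K : Type*} [NormedAddCommGroup K] [InnerProductSpace ℂ K] [CompleteSpace K]

instance : CoeSort (OperatorSystem K) (Type _) := ⟨fun M => M.toSubmodule⟩

/-- The unit of an operator system. -/
def unit (M : OperatorSystem K) : M := ⟨1, M.one_mem'⟩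

/-- A representation of an operator system: a positive unital real-linear map into `B(H)`. -/
structure IsRepresentation (M : OperatorSystem K) {H : Type*} [NormedAddCommGroup H]
    [InnerProductSpace ℂ H] (T : M →ₗ[ℝ] (H →L[ℂ] H)) : Prop where
  nonneg : ∀ a : M, 0 ≤ (a : K →L[ℂ] K) → 0 ≤ T a
  map_unit : T M.unit = 1

end Basic

section Products

variable {KA KB : Type*}
  [NormedAddCommGroup KA] [InnerProductSpace ℂ KA] [CompleteSpace KA]
  [NormedAddCommGroup KB] [InnerProductSpace ℂ KB] [CompleteSpace KB]
  {MA : OperatorSystem KA} {MB : OperatorSystem KB}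

/-- Two linear maps into `B(H)` have commuting ranges. -/
def CommutingRanges {H : Type*} [NormedAddCommGroup H] [InnerProductSpace ℂ H]
    (TA : MA →ₗ[ℝ] (H →L[ℂ] H)) (TB : MB →ₗ[ℝ] (H →L[ℂ] H)) : Prop :=
  ∀ (a : MA) (b : MB), Commute (TA a) (TB b)

/-- The linear map `TA · TB : a ⊗ b ↦ TA a * TB b`. -/
noncomputable def prodMap {H : Type*} [NormedAddCommGroup H] [InnerProductSpace ℂ H]
    (TA : MA →ₗ[ℝ] (H →L[ℂ] H)) (TB : MB →ₗ[ℝ] (H →L[ℂ] H)) :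
    (MA ⊗[ℝ] MB) →ₗ[ℝ] (H →L[ℂ] H) :=
  TensorProduct.lift ((LinearMap.mul ℝ (H →L[ℂ] H)).compl₁₂ TA TB)

/-- The Hilbert space tensor product: the completion of the algebraic tensor product for the
inner product with `⟪x ⊗ y, x' ⊗ y'⟫ = ⟪x, x'⟫ * ⟪y, y'⟫`. -/
abbrev HilbertTensor (HA HB : Type*) [NormedAddCommGroup HA] [InnerProductSpace ℂ HA]
    [NormedAddCommGroup HB] [InnerProductSpace ℂ HB] : Type _ :=
  UniformSpace.Completion (HA ⊗[ℂ] HB)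

section HilbertTensor

variable {HA HB : Type*} [NormedAddCommGroup HA] [InnerProductSpace ℂ HA]
  [NormedAddCommGroup HB] [InnerProductSpace ℂ HB]

/-- The bounded operator `X ⊗ Y` on the Hilbert space tensor product. -/
noncomputable def opTensor (X : HA →L[ℂ] HA) (Y : HB →L[ℂ] HB) :
    HilbertTensor HA HB →L[ℂ] HilbertTensor HA HB :=
  (TensorProduct.mapL X Y).completion

@[simp] theorem opTensor_coe (X : HA →L[ℂ] HA) (Y : HB →L[ℂ] HB) (v : HA ⊗[ℂ] HB) :
    opTensor X Y (v : HilbertTensor HA HB) = ((TensorProduct.mapL X Y v : HA ⊗[ℂ] HB) :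
      HilbertTensor HA HB) :=
  (TensorProduct.mapL X Y).completion_apply_coe v

theorem opTensor_ext {S T : HilbertTensor HA HB →L[ℂ] HilbertTensor HA HB}
    (h : ∀ v : HA ⊗[ℂ] HB, S (v : HilbertTensor HA HB) = T (v : HilbertTensor HA HB)) :
    S = T :=
  ContinuousLinearMap.ext fun x =>
    UniformSpace.Completion.induction_on x (isClosed_eq S.continuous T.continuous) h

theorem opTensor_add_left (X X' : HA →L[ℂ] HA) (Y : HB →L[ℂ] HB) :
    opTensor (X + X') Y = opTensor X Y + opTensor X' Y :=
  opTensor_ext fun v => by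
    rw [add_apply]
    simp only [opTensor_coe, TensorProduct.mapL_add_left, add_apply,
      UniformSpace.Completion.coe_add]

theorem opTensor_add_right (X : HA →L[ℂ] HA) (Y Y' : HB →L[ℂ] HB) :
    opTensor X (Y + Y') = opTensor X Y + opTensor X Y' :=
  opTensor_ext fun v => by
    rw [add_apply]
    simp only [opTensor_coe, TensorProduct.mapL_add_right, add_apply,
      UniformSpace.Completion.coe_add]

theorem opTensor_smul_left (c : ℝ) (X : HA →L[ℂ] HA) (Y : HB →L[ℂ] HB) :
    opTensor (c • X) Y = c • opTensor X Y := by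
  rw [← Complex.coe_smul c X, ← Complex.coe_smul c (opTensor X Y)]
  refine opTensor_ext fun v => ?_
  rw [smul_apply]
  simp only [opTensor_coe, TensorProduct.mapL_smul_left, smul_apply,
    UniformSpace.Completion.coe_smul]

theorem opTensor_smul_right (c : ℝ) (X : HA →L[ℂ] HA) (Y : HB →L[ℂ] HB) :
    opTensor X (c • Y) = c • opTensor X Y := by
  rw [← Complex.coe_smul c Y, ← Complex.coe_smul c (opTensor X Y)]
  refine opTensor_ext fun v => ?_
  rw [smul_apply]
  simp only [opTensor_coe, TensorProduct.mapL_smul_right, smul_apply,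
    UniformSpace.Completion.coe_smul]

/-- The linear map `TA ⊗ TB : a ⊗ b ↦ TA a ⊗ TB b`. -/
noncomputable def tensorMap (TA : MA →ₗ[ℝ] (HA →L[ℂ] HA)) (TB : MB →ₗ[ℝ] (HB →L[ℂ] HB)) :
    (MA ⊗[ℝ] MB) →ₗ[ℝ] (HilbertTensor HA HB →L[ℂ] HilbertTensor HA HB) :=
  TensorProduct.lift (LinearMap.mk₂ ℝ (fun a b => opTensor (TA a) (TB b))
    (fun a a' b => by rw [map_add, opTensor_add_left])
    (fun c a b => by rw [map_smul, opTensor_smul_left])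
    (fun a b b' => by rw [map_add, opTensor_add_right])
    (fun c a b => by rw [map_smul, opTensor_smul_right]))

end HilbertTensor

end Products

section Norms

variable {KA KB : Type u}
  [NormedAddCommGroup KA] [InnerProductSpace ℂ KA] [CompleteSpace KA]
  [NormedAddCommGroup KB] [InnerProductSpace ℂ KB] [CompleteSpace KB]
  {MA : OperatorSystem KA} {MB : OperatorSystem KB}

/-- The p-maximal tensor norm: the supremum of `‖TA · TB (z)‖` over all pairs of representations
with commuting ranges on a common Hilbert space. -/
noncomputable def pmaxNorm (z : MA ⊗[ℝ] MB) : ℝ :=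
  sSup {r : ℝ | ∃ (H : Type u) (_ : NormedAddCommGroup H) (_ : InnerProductSpace ℂ H)
    (_ : CompleteSpace H) (TA : MA →ₗ[ℝ] (H →L[ℂ] H)) (TB : MB →ₗ[ℝ] (H →L[ℂ] H)),
    MA.IsRepresentation TA ∧ MB.IsRepresentation TB ∧ CommutingRanges TA TB ∧
      r = ‖prodMap TA TB z‖}

/-- The p-minimal tensor norm: the supremum of `‖TA ⊗ TB (z)‖` over all pairs of representations
on two Hilbert spaces. -/
noncomputable def pminNorm (z : MA ⊗[ℝ] MB) : ℝ :=
  sSup {r : ℝ | ∃ (HA : Type u) (_ : NormedAddCommGroup HA) (_ : InnerProductSpace ℂ HA)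
    (_ : CompleteSpace HA) (HB : Type u) (_ : NormedAddCommGroup HB)
    (_ : InnerProductSpace ℂ HB) (_ : CompleteSpace HB)
    (TA : MA →ₗ[ℝ] (HA →L[ℂ] HA)) (TB : MB →ₗ[ℝ] (HB →L[ℂ] HB)),
    MA.IsRepresentation TA ∧ MB.IsRepresentation TB ∧ r = ‖tensorMap TA TB z‖}

/-- `z` is positive for the p-maximal tensor product: `TA · TB (z)` is a positive operator for all
pairs of representations with commuting ranges. -/
def PmaxPositive (z : MA ⊗[ℝ] MB) : Prop :=
  ∀ (H : Type u) [NormedAddCommGroup H] [InnerProductSpace ℂ H] [CompleteSpace H]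
    (TA : MA →ₗ[ℝ] (H →L[ℂ] H)) (TB : MB →ₗ[ℝ] (H →L[ℂ] H)),
    MA.IsRepresentation TA → MB.IsRepresentation TB → CommutingRanges TA TB →
      0 ≤ prodMap TA TB z

/-- A state on the p-maximal tensor product: a linear functional that is nonnegative on positive
elements and takes the value `1` at `1 ⊗ 1`. -/
structure IsPmaxState (ω : (MA ⊗[ℝ] MB) →ₗ[ℝ] ℝ) : Prop where
  nonneg : ∀ z, PmaxPositive z → 0 ≤ ω z
  map_unit : ω (MA.unit ⊗ₜ[ℝ] MB.unit) = 1

end Norms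

end OperatorSystem

/-- A state on `B(H)`: a positive linear functional with value `1` at the identity. -/
structure IsOperatorState {H : Type*} [NormedAddCommGroup H] [InnerProductSpace ℂ H]
    (φ : (H →L[ℂ] H) →ₗ[ℂ] ℂ) : Prop where
  nonneg : ∀ X : H →L[ℂ] H, 0 ≤ X → 0 ≤ φ X
  map_one : φ 1 = 1

/-! ### Quadratic forms, norms and states of symmetric operators -/

section Operators

variable {H : Type*} [NormedAddCommGroup H] [InnerProductSpace ℂ H]

/-! Amplifying by the identity turns a pair of representations on two spaces into a commuting pair
on their tensor product, so pmin ≤ pmax always holds (`pminNorm_le_pmaxNorm`). Only the reverse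
inequality is at stake.

(ii) ⇒ (i). In finite dimension a commuting pair is an orthogonal sum of tensor product pairs. An
irreducible subspace V for the A-operators comes with its space of intertwiners V → H, on which the
B-operators act. Schur's lemma makes V tensored with this multiplicity space an isometric copy of a
subspace of H (`exists_tensor_subrepresentation`). Splitting it off and inducting on the dimension
bounds finite-dimensional commuting pairs by the pmin norm (`norm_prodMap_le_pminNorm`).
Approximation carries this bound over to every pmax state, in particular to unit vector functionals
of arbitrary commuting pairs. Since the operators are symmetric, those functionals determine the
pmax norm.

(i) ⇒ (ii). If every tensor product vector functional were at most ω(z) − δ at z, then adding a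
large multiple of the unit to z would give an element whose pmin norm lies below the value of ω,
hence below its pmax norm (`exists_lt_inner_algTensorMap`). A good vector can be taken in the
algebraic tensor product, so it lies in a tensor product of finite-dimensional subspaces, and
compressing to these keeps the maps positive and unital. The same argument for −z gives
finite-dimensional values on the other side of ω(z). Direct sums make the set of values convex, so
some value falls within ε of ω(z). Because z is fixed in (ii), no separation theorem is needed. -/

/-- Nonnegativity in ℂ includes being real, and over ℂ a real quadratic form already forces
symmetry. Completeness plays no role, so this applies to algebraic tensor products. -/
theorem ContinuousLinearMap.nonneg_iff_forall_inner (X : H →L[ℂ] H) :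
    0 ≤ X ↔ ∀ v, 0 ≤ inner ℂ (X v) v := by
  rw [ContinuousLinearMap.nonneg_iff_isPositive]
  refine ⟨fun h v => h.inner_nonneg_left v, fun h => ?_⟩
  rw [ContinuousLinearMap.isPositive_iff_complex]
  intro v
  have h1 := Complex.nonneg_iff.1 (h v)
  refine ⟨Complex.ext (by simp) (by simp [h1.2]), h1.1⟩

theorem complex_inner_self_nonneg (v : H) : 0 ≤ inner ℂ v v :=
  Complex.nonneg_iff.2 ⟨inner_self_nonneg (𝕜 := ℂ), (inner_self_im (𝕜 := ℂ) v).symm⟩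

theorem ContinuousLinearMap.norm_le_of_isSymmetric {X : H →L[ℂ] H}
    (hX : (X : H →ₗ[ℂ] H).IsSymmetric) {M : ℝ} (hM : 0 ≤ M)
    (h : ∀ v, |(inner ℂ (X v) v).re| ≤ M * ‖v‖ ^ 2) : ‖X‖ ≤ M := by
  rw [X.norm_eq_iSup_rayleighQuotient hX]
  refine Real.iSup_le (fun v => ?_) hM
  rw [ContinuousLinearMap.rayleighQuotient, abs_div, abs_of_nonneg (sq_nonneg ‖v‖)]
  exact div_le_of_le_mul₀ (sq_nonneg _) hM (h v)

theorem ContinuousLinearMap.abs_re_inner_le (X : H →L[ℂ] H) (v : H) :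
    |(inner ℂ (X v) v).re| ≤ ‖X‖ * ‖v‖ ^ 2 := by
  calc |(inner ℂ (X v) v).re| ≤ ‖inner ℂ (X v) v‖ := Complex.abs_re_le_norm _
    _ ≤ ‖X v‖ * ‖v‖ := norm_inner_le_norm _ _
    _ ≤ (‖X‖ * ‖v‖) * ‖v‖ := by gcongr; exact X.le_opNorm v
    _ = _ := by ring

theorem ContinuousLinearMap.nonneg_of_isSymmetric {X : H →L[ℂ] H}
    (hX : (X : H →ₗ[ℂ] H).IsSymmetric) (h : ∀ v, 0 ≤ (inner ℂ (X v) v).re) : 0 ≤ X := by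
  rw [ContinuousLinearMap.nonneg_iff_isPositive, ContinuousLinearMap.isPositive_def]
  exact ⟨hX, h⟩

theorem ContinuousLinearMap.real_smul_one_isSymmetric (c : ℝ) :
    ((c • (1 : H →L[ℂ] H) : H →L[ℂ] H) : H →ₗ[ℂ] H).IsSymmetric := by
  intro x y
  simp [inner_smul_left, inner_smul_right, ← Complex.coe_smul]

theorem ContinuousLinearMap.re_inner_real_smul_one (c : ℝ) (v : H) :
    (inner ℂ ((c • (1 : H →L[ℂ] H)) v) v).re = c * ‖v‖ ^ 2 := by
  rw [smul_apply, one_apply_eq_self, ← Complex.coe_smul,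
    inner_smul_left, inner_self_eq_norm_sq_to_K]
  simp [← Complex.ofReal_pow]

theorem ContinuousLinearMap.norm_smul_one_add_nonneg {X : H →L[ℂ] H}
    (hX : (X : H →ₗ[ℂ] H).IsSymmetric) {c : ℝ} (hc : ‖X‖ ≤ c) : 0 ≤ c • (1 : H →L[ℂ] H) + X := by
  refine nonneg_of_isSymmetric ((real_smul_one_isSymmetric c).add hX) fun v => ?_
  have h1 := neg_le_of_abs_le (X.abs_re_inner_le v)
  rw [add_apply, inner_add_left, Complex.add_re, re_inner_real_smul_one]
  nlinarith [sq_nonneg ‖v‖]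

theorem ContinuousLinearMap.norm_smul_one_sub_nonneg {X : H →L[ℂ] H}
    (hX : (X : H →ₗ[ℂ] H).IsSymmetric) {c : ℝ} (hc : ‖X‖ ≤ c) : 0 ≤ c • (1 : H →L[ℂ] H) - X := by
  rw [sub_eq_add_neg]
  refine norm_smul_one_add_nonneg (X := -X) ?_ (by rwa [norm_neg])
  intro x y
  simpa using hX x y

/-- Apply the state to the positive operators ‖X‖ ± X. Their nonnegative values bound the real part
on both sides and also show that `φ X` is real. -/
theorem IsOperatorState.norm_apply_le {φ : (H →L[ℂ] H) →ₗ[ℂ] ℂ} (hφ : IsOperatorState φ)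
    {X : H →L[ℂ] H} (hX : (X : H →ₗ[ℂ] H).IsSymmetric) : ‖φ X‖ ≤ ‖X‖ := by
  have h1 := hφ.nonneg _ (ContinuousLinearMap.norm_smul_one_add_nonneg hX le_rfl)
  have h2 := hφ.nonneg _ (ContinuousLinearMap.norm_smul_one_sub_nonneg hX le_rfl)
  rw [← Complex.coe_smul] at h1 h2
  rw [map_add, map_smul, hφ.map_one, Complex.nonneg_iff] at h1
  rw [map_sub, map_smul, hφ.map_one, Complex.nonneg_iff] at h2
  simp at h1 h2
  have h3 : φ X = ((φ X).re : ℂ) := Complex.ext (by simp) (by simp [← h1.2])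
  rw [h3, Complex.norm_real, Real.norm_eq_abs, abs_le]
  constructor <;> linarith

end Operators

/-! ### Representations and products of commuting pairs -/

namespace OperatorSystem

/-- Real-linear maps between operator algebras. -/
abbrev OpMap (H G : Type*) [NormedAddCommGroup H] [InnerProductSpace ℂ H]
    [NormedAddCommGroup G] [InnerProductSpace ℂ G] : Type _ :=
  (H →L[ℂ] H) →ₗ[ℝ] (G →L[ℂ] G)

/-- A complex-linear map between operator algebras, regarded as a real-linear map. -/
noncomputable def OpMap.ofComplex {H G : Type*} [NormedAddCommGroup H] [InnerProductSpace ℂ H]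
    [NormedAddCommGroup G] [InnerProductSpace ℂ G]
    (L : (H →L[ℂ] H) →ₗ[ℂ] (G →L[ℂ] G)) : OpMap H G :=
  L.restrictScalars ℝ

section Representations

variable {K : Type*} [NormedAddCommGroup K] [InnerProductSpace ℂ K] [CompleteSpace K]
  {M : OperatorSystem K} {H : Type*} [NormedAddCommGroup H] [InnerProductSpace ℂ H]

theorem isSymmetric_coe (a : M) : ((a : K →L[ℂ] K) : K →ₗ[ℂ] K).IsSymmetric :=
  (M.isSelfAdjoint_of_mem' _ a.2).isSymmetric

/-- Positivity makes the image of ‖a‖·1 + a positive, hence symmetric; subtract the multiple of the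
identity. -/
theorem IsRepresentation.isSymmetric {T : M →ₗ[ℝ] (H →L[ℂ] H)} (hT : M.IsRepresentation T)
    (a : M) : (T a : H →ₗ[ℂ] H).IsSymmetric := by
  have h := hT.nonneg (‖(a : K →L[ℂ] K)‖ • M.unit + a)
    (ContinuousLinearMap.norm_smul_one_add_nonneg (isSymmetric_coe a) le_rfl)
  rw [map_add, map_smul, hT.map_unit, ContinuousLinearMap.nonneg_iff_isPositive] at h
  have h2 := h.isSymmetric.sub
    (ContinuousLinearMap.real_smul_one_isSymmetric (H := H) ‖(a : K →L[ℂ] K)‖)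
  simpa using h2

theorem IsRepresentation.norm_le {T : M →ₗ[ℝ] (H →L[ℂ] H)} (hT : M.IsRepresentation T)
    (a : M) : ‖T a‖ ≤ ‖(a : K →L[ℂ] K)‖ := by
  have h1 := hT.nonneg (‖(a : K →L[ℂ] K)‖ • M.unit + a)
    (ContinuousLinearMap.norm_smul_one_add_nonneg (isSymmetric_coe a) le_rfl)
  have h2 := hT.nonneg (‖(a : K →L[ℂ] K)‖ • M.unit - a)
    (ContinuousLinearMap.norm_smul_one_sub_nonneg (isSymmetric_coe a) le_rfl)
  rw [map_add, map_smul, hT.map_unit, ContinuousLinearMap.nonneg_iff_isPositive] at h1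
  rw [map_sub, map_smul, hT.map_unit, ContinuousLinearMap.nonneg_iff_isPositive] at h2
  refine ContinuousLinearMap.norm_le_of_isSymmetric (hT.isSymmetric a) (norm_nonneg _) fun v => ?_
  have h3 := h1.re_inner_nonneg_left v
  have h4 := h2.re_inner_nonneg_left v
  rw [add_apply, inner_add_left, map_add, RCLike.re_eq_complex_re,
    ContinuousLinearMap.re_inner_real_smul_one] at h3
  rw [sub_apply, inner_sub_left, map_sub, RCLike.re_eq_complex_re,
    ContinuousLinearMap.re_inner_real_smul_one] at h4
  rw [abs_le]
  constructor <;> linarith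

theorem IsRepresentation.comp {T : M →ₗ[ℝ] (H →L[ℂ] H)} (hT : M.IsRepresentation T)
    {G : Type*} [NormedAddCommGroup G] [InnerProductSpace ℂ G]
    (Φ : OpMap H G) (hΦ : ∀ X, 0 ≤ X → 0 ≤ Φ X) (hΦ1 : Φ 1 = 1) :
    M.IsRepresentation (Φ ∘ₗ T) where
  nonneg a ha := hΦ _ (hT.nonneg a ha)
  map_unit := by rw [LinearMap.comp_apply, hT.map_unit, hΦ1]

end Representations

section Products

variable {KA KB : Type*}
  [NormedAddCommGroup KA] [InnerProductSpace ℂ KA] [CompleteSpace KA]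
  [NormedAddCommGroup KB] [InnerProductSpace ℂ KB] [CompleteSpace KB]
  {MA : OperatorSystem KA} {MB : OperatorSystem KB}
  {H : Type*} [NormedAddCommGroup H] [InnerProductSpace ℂ H]
  {TA : MA →ₗ[ℝ] (H →L[ℂ] H)} {TB : MB →ₗ[ℝ] (H →L[ℂ] H)}

@[simp] theorem prodMap_tmul (a : MA) (b : MB) : prodMap TA TB (a ⊗ₜ[ℝ] b) = TA a * TB b := rfl

theorem prodMap_unit (hA : MA.IsRepresentation TA) (hB : MB.IsRepresentation TB) :
    prodMap TA TB (MA.unit ⊗ₜ[ℝ] MB.unit) = 1 := by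
  rw [prodMap_tmul, hA.map_unit, hB.map_unit, one_mul]

theorem isSymmetric_prodMap (hA : MA.IsRepresentation TA) (hB : MB.IsRepresentation TB)
    (hAB : CommutingRanges TA TB) (z : MA ⊗[ℝ] MB) :
    (prodMap TA TB z : H →ₗ[ℂ] H).IsSymmetric := by
  induction z with
  | zero => simp
  | tmul a b =>
    intro x y
    have h := hAB a b
    have h2 : ∀ v, TA a (TB b v) = TB b (TA a v) := fun v => congrArg (fun X : H →L[ℂ] H => X v) h
    have h3 := hA.isSymmetric a (TB b x) y
    have h4 := hB.isSymmetric b x (TA a y)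
    simp only [ContinuousLinearMap.coe_coe] at h3 h4
    simp [← h4, ← h3, h2]
  | add x y hx hy => rw [map_add]; exact hx.add hy

/-- The bound is uniform in the Hilbert space. It makes the set in `pmaxNorm` bounded above, without
which the real `sSup` would carry no information. -/
theorem exists_norm_prodMap_le (z : MA ⊗[ℝ] MB) : ∃ C : ℝ, ∀ (H : Type u)
    [NormedAddCommGroup H] [InnerProductSpace ℂ H]
    (TA : MA →ₗ[ℝ] (H →L[ℂ] H)) (TB : MB →ₗ[ℝ] (H →L[ℂ] H)),
    MA.IsRepresentation TA → MB.IsRepresentation TB → ‖prodMap TA TB z‖ ≤ C := by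
  induction z with
  | zero => exact ⟨0, fun _ _ _ _ _ _ _ => by simp⟩
  | tmul a b =>
    refine ⟨‖(a : KA →L[ℂ] KA)‖ * ‖(b : KB →L[ℂ] KB)‖, fun _ _ _ _ _ hA hB => ?_⟩
    exact (norm_mul_le _ _).trans
      (mul_le_mul (hA.norm_le a) (hB.norm_le b) (norm_nonneg _) (norm_nonneg _))
  | add x y hx hy =>
    obtain ⟨C, hC⟩ := hx
    obtain ⟨D, hD⟩ := hy
    refine ⟨C + D, fun _ _ _ _ _ hA hB => ?_⟩
    rw [map_add]
    exact (norm_add_le _ _).trans (add_le_add (hC _ _ _ hA hB) (hD _ _ _ hA hB))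

/-- Used to pass to invariant subspaces, both the embedded tensor product and its orthogonal
complement. -/
theorem prodMap_apply_intertwine {G : Type*} [NormedAddCommGroup G] [InnerProductSpace ℂ G]
    {SA : MA →ₗ[ℝ] (G →L[ℂ] G)} {SB : MB →ₗ[ℝ] (G →L[ℂ] G)} (J : G →ₗ[ℂ] H)
    (hA : ∀ a x, TA a (J x) = J (SA a x)) (hB : ∀ b x, TB b (J x) = J (SB b x))
    (z : MA ⊗[ℝ] MB) (x : G) : prodMap TA TB z (J x) = J (prodMap SA SB z x) := by
  induction z with
  | zero => simp
  | tmul a b => simp [hA, hB]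
  | add z w hz hw => simp [hz, hw]

theorem prodMap_comp {G : Type*} [NormedAddCommGroup G] [InnerProductSpace ℂ G]
    (Φ : OpMap H G) (hΦ : ∀ X Y, Φ (X * Y) = Φ X * Φ Y)
    (z : MA ⊗[ℝ] MB) : prodMap (Φ ∘ₗ TA) (Φ ∘ₗ TB) z = Φ (prodMap TA TB z) := by
  induction z with
  | zero => simp
  | tmul a b => simp [hΦ]
  | add z w hz hw => simp only [map_add, hz, hw]

end Products

/-! ### Amplification to tensor products and extension to completions -/

section Amplification

variable {HA HB : Type*} [NormedAddCommGroup HA] [InnerProductSpace ℂ HA]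
  [NormedAddCommGroup HB] [InnerProductSpace ℂ HB]

/-- The amplification `X ↦ X ⊗ 1` to the algebraic tensor product. -/
noncomputable def leftAmp : OpMap HA (HA ⊗[ℂ] HB) :=
  OpMap.ofComplex
    { toFun := fun X => TensorProduct.mapL X 1
      map_add' := fun X Y => TensorProduct.mapL_add_left X Y _
      map_smul' := fun c X => TensorProduct.mapL_smul_left c X _ }

/-- The amplification `Y ↦ 1 ⊗ Y` to the algebraic tensor product. -/
noncomputable def rightAmp : OpMap HB (HA ⊗[ℂ] HB) :=
  OpMap.ofComplex
    { toFun := fun Y => TensorProduct.mapL 1 Y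
      map_add' := fun X Y => TensorProduct.mapL_add_right _ X Y
      map_smul' := fun c Y => TensorProduct.mapL_smul_right c _ Y }

theorem leftAmp_apply (X : HA →L[ℂ] HA) :
    (leftAmp X : HA ⊗[ℂ] HB →L[ℂ] HA ⊗[ℂ] HB) = TensorProduct.mapL X 1 := rfl

theorem rightAmp_apply (X : HB →L[ℂ] HB) :
    (rightAmp X : HA ⊗[ℂ] HB →L[ℂ] HA ⊗[ℂ] HB) = TensorProduct.mapL 1 X := rfl

theorem leftAmp_one : (leftAmp 1 : HA ⊗[ℂ] HB →L[ℂ] HA ⊗[ℂ] HB) = 1 :=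
  TensorProduct.mapL_id_id

theorem rightAmp_one : (rightAmp 1 : HA ⊗[ℂ] HB →L[ℂ] HA ⊗[ℂ] HB) = 1 :=
  TensorProduct.mapL_id_id

theorem leftAmp_mul_rightAmp (X : HA →L[ℂ] HA) (Y : HB →L[ℂ] HB) :
    leftAmp X * rightAmp Y = TensorProduct.mapL X Y := by
  rw [leftAmp_apply, rightAmp_apply, ← TensorProduct.mapL_mul, one_mul, mul_one]

theorem rightAmp_mul_leftAmp (X : HA →L[ℂ] HA) (Y : HB →L[ℂ] HB) :
    rightAmp Y * leftAmp X = TensorProduct.mapL X Y := by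
  rw [leftAmp_apply, rightAmp_apply, ← TensorProduct.mapL_mul, one_mul, mul_one]

theorem inner_mapL_star [CompleteSpace HA] [CompleteSpace HB] (X : HA →L[ℂ] HA)
    (Y : HB →L[ℂ] HB) (v w : HA ⊗[ℂ] HB) :
    inner ℂ (TensorProduct.mapL (star X) (star Y) v) w = inner ℂ v (TensorProduct.mapL X Y w) := by
  induction v with
  | zero => simp
  | add v v' hv hv' => rw [map_add, inner_add_left, inner_add_left, hv, hv']
  | tmul a b =>
    induction w with
    | zero => simp
    | add v v' hv hv' => rw [map_add, inner_add_right, inner_add_right, hv, hv']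
    | tmul c d =>
      simp only [TensorProduct.mapL_tmul, TensorProduct.inner_tmul,
        ContinuousLinearMap.star_eq_adjoint, ContinuousLinearMap.adjoint_inner_left]

/-- With X = S†S and Y = T†T, the form of X ⊗ Y at v is ‖(S ⊗ T)v‖². The factors are complete but
their algebraic tensor product need not be, so `inner_mapL_star` stands in for the adjoint. -/
theorem mapL_nonneg [CompleteSpace HA] [CompleteSpace HB] {X : HA →L[ℂ] HA} {Y : HB →L[ℂ] HB}
    (hX : 0 ≤ X) (hY : 0 ≤ Y) : 0 ≤ TensorProduct.mapL X Y := by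
  obtain ⟨S, rfl⟩ := CStarAlgebra.nonneg_iff_eq_star_mul_self.mp hX
  obtain ⟨T, rfl⟩ := CStarAlgebra.nonneg_iff_eq_star_mul_self.mp hY
  rw [ContinuousLinearMap.nonneg_iff_forall_inner, TensorProduct.mapL_mul]
  intro v
  rw [mul_apply_eq_comp, inner_mapL_star]
  exact complex_inner_self_nonneg (H := HA ⊗[ℂ] HB) _

theorem leftAmp_nonneg [CompleteSpace HA] [CompleteSpace HB] {X : HA →L[ℂ] HA} (hX : 0 ≤ X) :
    0 ≤ (leftAmp X : HA ⊗[ℂ] HB →L[ℂ] HA ⊗[ℂ] HB) :=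
  mapL_nonneg hX ((ContinuousLinearMap.nonneg_iff_isPositive _).2 ContinuousLinearMap.isPositive_one)

theorem rightAmp_nonneg [CompleteSpace HA] [CompleteSpace HB] {X : HB →L[ℂ] HB} (hX : 0 ≤ X) :
    0 ≤ (rightAmp X : HA ⊗[ℂ] HB →L[ℂ] HA ⊗[ℂ] HB) :=
  mapL_nonneg ((ContinuousLinearMap.nonneg_iff_isPositive _).2 ContinuousLinearMap.isPositive_one) hX

/-- The extension of bounded operators to the completion. -/
noncomputable def completionMap {H : Type*} [NormedAddCommGroup H] [InnerProductSpace ℂ H] :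
    OpMap H (UniformSpace.Completion H) :=
  OpMap.ofComplex
    { toFun := fun X => X.completion
      map_add' := fun X Y => ContinuousLinearMap.ext fun x =>
        UniformSpace.Completion.induction_on x
          (isClosed_eq (ContinuousLinearMap.continuous _) (ContinuousLinearMap.continuous _))
          fun v => by
            rw [add_apply]
            simp only [ContinuousLinearMap.completion_apply_coe, add_apply,
              UniformSpace.Completion.coe_add]
      map_smul' := fun c X => ContinuousLinearMap.ext fun x =>
        UniformSpace.Completion.induction_on x
          (isClosed_eq (ContinuousLinearMap.continuous _) (ContinuousLinearMap.continuous _))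
          fun v => by
            rw [RingHom.id_apply, smul_apply]
            simp only [ContinuousLinearMap.completion_apply_coe, smul_apply,
              UniformSpace.Completion.coe_smul] }

section Completion

variable {H : Type*} [NormedAddCommGroup H] [InnerProductSpace ℂ H]

@[simp] theorem completionMap_coe (X : H →L[ℂ] H) (v : H) :
    completionMap X (v : UniformSpace.Completion H) = (X v : H) :=
  X.completion_apply_coe v

theorem completionMap_ext {S T : UniformSpace.Completion H →L[ℂ] UniformSpace.Completion H}
    (h : ∀ v : H, S (v : UniformSpace.Completion H) = T (v : UniformSpace.Completion H)) : S = T :=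
  ContinuousLinearMap.ext fun x => UniformSpace.Completion.induction_on x
    (isClosed_eq S.continuous T.continuous) h

theorem completionMap_one : completionMap (1 : H →L[ℂ] H) = 1 :=
  completionMap_ext fun v => by simp

theorem completionMap_mul (X Y : H →L[ℂ] H) :
    completionMap (X * Y) = completionMap X * completionMap Y :=
  completionMap_ext fun v => by simp

theorem completionMap_nonneg {X : H →L[ℂ] H} (hX : 0 ≤ X) : 0 ≤ completionMap X := by
  rw [ContinuousLinearMap.nonneg_iff_forall_inner] at hX ⊢
  intro v
  refine UniformSpace.Completion.induction_on v ?_ fun w => ?_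
  · refine isClosed_le continuous_const ?_
    fun_prop
  · rw [completionMap_coe, UniformSpace.Completion.inner_coe]
    exact hX w

end Completion

end Amplification

end OperatorSystem

namespace OperatorSystem

/-! ### Tensor product representations as commuting pairs -/

section TensorMap

variable {KA KB : Type*}
  [NormedAddCommGroup KA] [InnerProductSpace ℂ KA] [CompleteSpace KA]
  [NormedAddCommGroup KB] [InnerProductSpace ℂ KB] [CompleteSpace KB]
  {MA : OperatorSystem KA} {MB : OperatorSystem KB}
  {HA HB : Type*} [NormedAddCommGroup HA] [InnerProductSpace ℂ HA]
  [NormedAddCommGroup HB] [InnerProductSpace ℂ HB]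

theorem IsRepresentation.leftAmp [CompleteSpace HA] [CompleteSpace HB]
    {T : MA →ₗ[ℝ] (HA →L[ℂ] HA)} (hT : MA.IsRepresentation T) :
    MA.IsRepresentation ((leftAmp : OpMap HA (HA ⊗[ℂ] HB)) ∘ₗ T) :=
  hT.comp _ (fun _ => leftAmp_nonneg) leftAmp_one

theorem IsRepresentation.rightAmp [CompleteSpace HA] [CompleteSpace HB]
    {T : MB →ₗ[ℝ] (HB →L[ℂ] HB)} (hT : MB.IsRepresentation T) :
    MB.IsRepresentation ((rightAmp : OpMap HB (HA ⊗[ℂ] HB)) ∘ₗ T) :=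
  hT.comp _ (fun _ => rightAmp_nonneg) rightAmp_one

theorem commutingRanges_amp (TA : MA →ₗ[ℝ] (HA →L[ℂ] HA)) (TB : MB →ₗ[ℝ] (HB →L[ℂ] HB)) :
    CommutingRanges ((leftAmp : OpMap HA (HA ⊗[ℂ] HB)) ∘ₗ TA)
      ((rightAmp : OpMap HB (HA ⊗[ℂ] HB)) ∘ₗ TB) := fun a b =>
  (leftAmp_mul_rightAmp (TA a) (TB b)).trans (rightAmp_mul_leftAmp (TA a) (TB b)).symm

theorem IsRepresentation.completionMap {M : OperatorSystem KA}
    {T : M →ₗ[ℝ] (HA →L[ℂ] HA)} (hT : M.IsRepresentation T) :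
    M.IsRepresentation ((completionMap : OpMap HA _) ∘ₗ T) :=
  hT.comp _ (fun _ => completionMap_nonneg) completionMap_one

theorem CommutingRanges.completionMap {TA : MA →ₗ[ℝ] (HA →L[ℂ] HA)}
    {TB : MB →ₗ[ℝ] (HA →L[ℂ] HA)} (h : CommutingRanges TA TB) :
    CommutingRanges ((completionMap : OpMap HA _) ∘ₗ TA)
      ((OperatorSystem.completionMap : OpMap HA _) ∘ₗ TB) := fun a b => by
  have h1 := h a b
  rw [commute_iff_eq] at h1 ⊢
  rw [LinearMap.comp_apply, LinearMap.comp_apply, ← completionMap_mul, h1, completionMap_mul]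

/-- The map `TA ⊗ TB` into the operators on the algebraic tensor product. -/
noncomputable def algTensorMap (TA : MA →ₗ[ℝ] (HA →L[ℂ] HA)) (TB : MB →ₗ[ℝ] (HB →L[ℂ] HB)) :=
  prodMap ((leftAmp : OpMap HA (HA ⊗[ℂ] HB)) ∘ₗ TA) ((rightAmp : OpMap HB (HA ⊗[ℂ] HB)) ∘ₗ TB)

theorem algTensorMap_tmul (TA : MA →ₗ[ℝ] (HA →L[ℂ] HA)) (TB : MB →ₗ[ℝ] (HB →L[ℂ] HB))
    (a : MA) (b : MB) :
    algTensorMap TA TB (a ⊗ₜ[ℝ] b) = TensorProduct.mapL (TA a) (TB b) :=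
  leftAmp_mul_rightAmp (TA a) (TB b)

theorem tensorMap_eq_completionMap (TA : MA →ₗ[ℝ] (HA →L[ℂ] HA)) (TB : MB →ₗ[ℝ] (HB →L[ℂ] HB))
    (z : MA ⊗[ℝ] MB) :
    tensorMap TA TB z = completionMap (algTensorMap TA TB z) := by
  induction z with
  | zero => rw [map_zero, map_zero, map_zero]
  | tmul a b =>
    rw [algTensorMap_tmul]
    rfl
  | add z w hz hw => rw [map_add, map_add, map_add, hz, hw]

theorem tensorMap_coe (TA : MA →ₗ[ℝ] (HA →L[ℂ] HA)) (TB : MB →ₗ[ℝ] (HB →L[ℂ] HB))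
    (z : MA ⊗[ℝ] MB) (v : HA ⊗[ℂ] HB) :
    tensorMap TA TB z (v : HilbertTensor HA HB) = (algTensorMap TA TB z v : HA ⊗[ℂ] HB) := by
  rw [tensorMap_eq_completionMap, completionMap_coe]

theorem tensorMap_eq_prodMap (TA : MA →ₗ[ℝ] (HA →L[ℂ] HA)) (TB : MB →ₗ[ℝ] (HB →L[ℂ] HB))
    (z : MA ⊗[ℝ] MB) :
    tensorMap TA TB z = prodMap ((completionMap : OpMap (HA ⊗[ℂ] HB) _) ∘ₗ leftAmp ∘ₗ TA)
      (completionMap ∘ₗ rightAmp ∘ₗ TB) z := by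
  rw [tensorMap_eq_completionMap]
  exact (prodMap_comp (TA := (leftAmp : OpMap HA (HA ⊗[ℂ] HB)) ∘ₗ TA)
    (TB := (rightAmp : OpMap HB (HA ⊗[ℂ] HB)) ∘ₗ TB) completionMap completionMap_mul z).symm

theorem norm_algTensorMap_apply_le (TA : MA →ₗ[ℝ] (HA →L[ℂ] HA))
    (TB : MB →ₗ[ℝ] (HB →L[ℂ] HB)) (z : MA ⊗[ℝ] MB) (v : HA ⊗[ℂ] HB) :
    ‖algTensorMap TA TB z v‖ ≤ ‖tensorMap TA TB z‖ * ‖v‖ := by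
  have h := (tensorMap TA TB z).le_opNorm (v : HilbertTensor HA HB)
  rwa [tensorMap_coe, UniformSpace.Completion.norm_coe, UniformSpace.Completion.norm_coe] at h

theorem isSymmetric_tensorMap [CompleteSpace HA] [CompleteSpace HB]
    {TA : MA →ₗ[ℝ] (HA →L[ℂ] HA)} {TB : MB →ₗ[ℝ] (HB →L[ℂ] HB)}
    (hA : MA.IsRepresentation TA) (hB : MB.IsRepresentation TB) (z : MA ⊗[ℝ] MB) :
    (tensorMap TA TB z : HilbertTensor HA HB →ₗ[ℂ] HilbertTensor HA HB).IsSymmetric := by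
  rw [tensorMap_eq_prodMap]
  exact isSymmetric_prodMap hA.leftAmp.completionMap hB.rightAmp.completionMap
    (commutingRanges_amp TA TB).completionMap z

end TensorMap

/-! ### Comparison of the two norms -/

section Norms

variable {KA KB : Type u}
  [NormedAddCommGroup KA] [InnerProductSpace ℂ KA] [CompleteSpace KA]
  [NormedAddCommGroup KB] [InnerProductSpace ℂ KB] [CompleteSpace KB]
  {MA : OperatorSystem KA} {MB : OperatorSystem KB}

theorem pmaxNorm_nonneg (z : MA ⊗[ℝ] MB) : 0 ≤ pmaxNorm z := by
  unfold pmaxNorm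
  apply Real.sSup_nonneg
  intro r hr
  obtain ⟨H, i1, i2, i3, TA, TB, -, -, -, hr⟩ := hr
  exact hr.symm ▸ norm_nonneg (prodMap TA TB z)

theorem pminNorm_nonneg (z : MA ⊗[ℝ] MB) : 0 ≤ pminNorm z := by
  unfold pminNorm
  apply Real.sSup_nonneg
  intro r hr
  obtain ⟨HA, _, _, _, HB, _, _, _, TA, TB, -, -, hr⟩ := hr
  exact hr.symm ▸ norm_nonneg (tensorMap TA TB z)

theorem norm_prodMap_le_pmaxNorm (z : MA ⊗[ℝ] MB) {H : Type u} [NormedAddCommGroup H]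
    [InnerProductSpace ℂ H] [CompleteSpace H] {TA : MA →ₗ[ℝ] (H →L[ℂ] H)}
    {TB : MB →ₗ[ℝ] (H →L[ℂ] H)} (hA : MA.IsRepresentation TA) (hB : MB.IsRepresentation TB)
    (hAB : CommutingRanges TA TB) : ‖prodMap TA TB z‖ ≤ pmaxNorm z := by
  obtain ⟨C, hC⟩ := exists_norm_prodMap_le.{u} z
  refine le_csSup ⟨C, ?_⟩ ⟨H, _, _, ‹_›, TA, TB, hA, hB, hAB, rfl⟩
  rintro r ⟨H, _, _, _, TA, TB, hA, hB, -, rfl⟩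
  exact hC H TA TB hA hB

section

variable {HA HB : Type u} [NormedAddCommGroup HA] [InnerProductSpace ℂ HA] [CompleteSpace HA]
  [NormedAddCommGroup HB] [InnerProductSpace ℂ HB] [CompleteSpace HB]
  {TA : MA →ₗ[ℝ] (HA →L[ℂ] HA)} {TB : MB →ₗ[ℝ] (HB →L[ℂ] HB)}

theorem norm_tensorMap_le_pmaxNorm (z : MA ⊗[ℝ] MB)
    (hA : MA.IsRepresentation TA) (hB : MB.IsRepresentation TB) :
    ‖tensorMap TA TB z‖ ≤ pmaxNorm z := by
  rw [tensorMap_eq_prodMap]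
  exact norm_prodMap_le_pmaxNorm z hA.leftAmp.completionMap hB.rightAmp.completionMap
    (commutingRanges_amp TA TB).completionMap

theorem norm_tensorMap_le_pminNorm (z : MA ⊗[ℝ] MB)
    (hA : MA.IsRepresentation TA) (hB : MB.IsRepresentation TB) :
    ‖tensorMap TA TB z‖ ≤ pminNorm z := by
  refine le_csSup ⟨pmaxNorm z, ?_⟩ ⟨HA, _, _, ‹_›, HB, _, _, ‹_›, TA, TB, hA, hB, rfl⟩
  rintro r ⟨HA, _, _, _, HB, _, _, _, TA, TB, hA, hB, rfl⟩
  exact norm_tensorMap_le_pmaxNorm z hA hB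

end

theorem pminNorm_le_pmaxNorm (z : MA ⊗[ℝ] MB) : pminNorm z ≤ pmaxNorm z := by
  refine Real.sSup_le ?_ (pmaxNorm_nonneg z)
  rintro r ⟨HA, _, _, _, HB, _, _, _, TA, TB, hA, hB, rfl⟩
  exact norm_tensorMap_le_pmaxNorm z hA hB

end Norms

/-! ### Compression along isometries -/

section Compression

variable {V H : Type*} [NormedAddCommGroup V] [InnerProductSpace ℂ V] [CompleteSpace V]
  [NormedAddCommGroup H] [InnerProductSpace ℂ H] [CompleteSpace H]

/-- The compression `X ↦ J† X J` along an isometry `J`, as a complex-linear map. -/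
noncomputable def compressionₗ (J : V →ₗᵢ[ℂ] H) : (H →L[ℂ] H) →ₗ[ℂ] (V →L[ℂ] V) where
  toFun X := (ContinuousLinearMap.adjoint J.toContinuousLinearMap) ∘L X ∘L J.toContinuousLinearMap
  map_add' X Y := by ext; simp
  map_smul' c X := by ext; simp

/-- The compression `X ↦ J† X J` along an isometry `J`. -/
noncomputable def compression (J : V →ₗᵢ[ℂ] H) : OpMap H V :=
  OpMap.ofComplex (compressionₗ J)

theorem compression_apply (J : V →ₗᵢ[ℂ] H) (X : H →L[ℂ] H) (v : V) :
    compression J X v = ContinuousLinearMap.adjoint J.toContinuousLinearMap (X (J v)) := rfl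

theorem inner_compression_left (J : V →ₗᵢ[ℂ] H) (X : H →L[ℂ] H) (v w : V) :
    inner ℂ (compression J X v) w = inner ℂ (X (J v)) (J w) := by
  rw [compression_apply, ContinuousLinearMap.adjoint_inner_left]
  rfl

theorem adjoint_apply_isometry (J : V →ₗᵢ[ℂ] H) (v : V) :
    ContinuousLinearMap.adjoint J.toContinuousLinearMap (J v) = v := by
  refine ext_inner_right ℂ fun w => ?_
  rw [ContinuousLinearMap.adjoint_inner_left]
  exact J.inner_map_map v w

theorem compression_one (J : V →ₗᵢ[ℂ] H) : compression J 1 = 1 := by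
  ext v
  exact adjoint_apply_isometry J v

theorem compression_nonneg (J : V →ₗᵢ[ℂ] H) {X : H →L[ℂ] H} (hX : 0 ≤ X) :
    0 ≤ compression J X := by
  rw [ContinuousLinearMap.nonneg_iff_forall_inner] at hX ⊢
  intro v
  rw [inner_compression_left]
  exact hX _

theorem apply_compression (J : V →ₗᵢ[ℂ] H) {X : H →L[ℂ] H}
    (hX : ∀ v, X (J v) ∈ Set.range J) (v : V) : J (compression J X v) = X (J v) := by
  obtain ⟨w, hw⟩ := hX v
  rw [compression_apply, ← hw, adjoint_apply_isometry]

/-- No invariance of the range of `J` is required, because representations need only be positive and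
unital. This permits cutting down to arbitrary finite-dimensional subspaces. -/
theorem IsRepresentation.compression {K : Type*} [NormedAddCommGroup K] [InnerProductSpace ℂ K]
    [CompleteSpace K] {M : OperatorSystem K} {T : M →ₗ[ℝ] (H →L[ℂ] H)} (hT : M.IsRepresentation T)
    (J : V →ₗᵢ[ℂ] H) : M.IsRepresentation (compression J ∘ₗ T) :=
  hT.comp _ (fun _ => compression_nonneg J) (compression_one J)

end Compression

end OperatorSystem

/-! ### Schur's lemma and tensor product subrepresentations -/

section Schur

variable {ι V H : Type*} [NormedAddCommGroup V] [InnerProductSpace ℂ V] [FiniteDimensional ℂ V]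
  [NormedAddCommGroup H] [InnerProductSpace ℂ H] [FiniteDimensional ℂ H]

/-- Schur's lemma: intertwiners out of an irreducible family of symmetric operators are multiples
of isometries, and so are their mutual inner products. -/
theorem exists_inner_intertwiner_eq [Nontrivial V] {S : ι → V →ₗ[ℂ] V} {T : ι → H →ₗ[ℂ] H}
    (hS : ∀ i, (S i).IsSymmetric) (hT : ∀ i, (T i).IsSymmetric)
    (hirr : ∀ U : Submodule ℂ V, (∀ i, ∀ x ∈ U, S i x ∈ U) → U = ⊥ ∨ U = ⊤)
    {f g : V →ₗ[ℂ] H} (hf : ∀ i v, f (S i v) = T i (f v)) (hg : ∀ i v, g (S i v) = T i (g v)) :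
    ∃ c : ℂ, ∀ v w, inner ℂ (f v) (g w) = c * inner ℂ v w := by
  set Q : V →ₗ[ℂ] V := LinearMap.adjoint f ∘ₗ g with hQ
  have hQi : ∀ v w, inner ℂ (f v) (g w) = inner ℂ v (Q w) := fun v w => by
    rw [hQ, LinearMap.comp_apply, LinearMap.adjoint_inner_right]
  -- f†g commutes with the family: move `S i` through g, across the inner product by symmetry of `T
  -- i`, and back through f.
  have hcomm : ∀ i w, Q (S i w) = S i (Q w) := fun i w => by
    refine ext_inner_left ℂ fun u => ?_
    rw [← hQi, hg, ← hT i, ← hf, hQi, hS i]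
  obtain ⟨μ, hμ⟩ := Module.End.exists_eigenvalue Q
  -- An eigenspace of Q is invariant and nonzero, so by irreducibility it is all of V and Q is
  -- scalar.
  rcases hirr (Module.End.eigenspace Q μ) (fun i x hx => by
    rw [Module.End.mem_eigenspace_iff] at hx ⊢
    rw [hcomm, hx, map_smul]) with h | h
  · exact absurd h hμ
  · refine ⟨μ, fun v w => ?_⟩
    have hw : w ∈ Module.End.eigenspace Q μ := h ▸ Submodule.mem_top
    rw [hQi, Module.End.mem_eigenspace_iff.1 hw, inner_smul_right]

theorem exists_minimal_invariant_submodule [Nontrivial H] (T : ι → H →ₗ[ℂ] H) :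
    ∃ V : Submodule ℂ H, V ≠ ⊥ ∧ (∀ i, ∀ x ∈ V, T i x ∈ V) ∧
      ∀ U ≤ V, (∀ i, ∀ x ∈ U, T i x ∈ U) → U = ⊥ ∨ U = V := by
  obtain ⟨V, ⟨h0, hV⟩, hmin⟩ := (wellFounded_lt (α := Submodule ℂ H)).has_min
    {U | U ≠ ⊥ ∧ ∀ i, ∀ x ∈ U, T i x ∈ U} ⟨⊤, top_ne_bot, fun _ _ _ => Submodule.mem_top⟩
  refine ⟨V, h0, hV, fun U hU hUi => ?_⟩
  by_contra! h
  exact hmin U ⟨h.1, hUi⟩ (lt_of_le_of_ne hU h.2)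

end Schur

namespace OperatorSystem

variable {KA KB : Type*}
  [NormedAddCommGroup KA] [InnerProductSpace ℂ KA] [CompleteSpace KA]
  [NormedAddCommGroup KB] [InnerProductSpace ℂ KB] [CompleteSpace KB]
  {MA : OperatorSystem KA} {MB : OperatorSystem KB}
  {H : Type*} [NormedAddCommGroup H] [InnerProductSpace ℂ H]
  {TA : MA →ₗ[ℝ] (H →L[ℂ] H)} {TB : MB →ₗ[ℝ] (H →L[ℂ] H)}

/-- Here W is a multiplicity space: each k in W gives an intertwiner `F k` from V to H. The
factorization `hF` is exactly what makes v ⊗ k ↦ `F k v` isometric. -/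
theorem exists_isometry_of_inner {V W : Type*} [NormedAddCommGroup V] [InnerProductSpace ℂ V]
    [NormedAddCommGroup W] [InnerProductSpace ℂ W] {SA : MA →ₗ[ℝ] (V →L[ℂ] V)}
    {SB : MB →ₗ[ℝ] (W →L[ℂ] W)} (F : W →ₗ[ℂ] V →ₗ[ℂ] H)
    (hF : ∀ k l v w, inner ℂ (F k v) (F l w) = inner ℂ v w * inner ℂ k l)
    (hFA : ∀ a k v, TA a (F k v) = F k (SA a v)) (hFB : ∀ b k v, TB b (F k v) = F (SB b k) v) :
    ∃ J : V ⊗[ℂ] W →ₗᵢ[ℂ] H, (∀ v k, J (v ⊗ₜ k) = F k v) ∧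
      (∀ a x, TA a (J x) = J (leftAmp (SA a) x)) ∧
      (∀ b x, TB b (J x) = J (rightAmp (SB b) x)) := by
  let U : V ⊗[ℂ] W →ₗ[ℂ] H := TensorProduct.lift F.flip
  have hU : ∀ v k, U (v ⊗ₜ k) = F k v := fun v k => rfl
  have hUin : ∀ x y, inner ℂ (U x) (U y) = inner ℂ x y := by
    intro x y
    induction x with
    | zero => simp
    | add x x' hx hx' => rw [map_add, inner_add_left, inner_add_left, hx, hx']
    | tmul v k =>
      induction y with
      | zero => simp
      | add x x' hx hx' => rw [map_add, inner_add_right, inner_add_right, hx, hx']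
      | tmul w l => rw [hU, hU, hF, TensorProduct.inner_tmul]
  refine ⟨U.isometryOfInner hUin, hU, ?_, ?_⟩
  · intro a x
    change TA a (U x) = U (leftAmp (SA a) x)
    induction x with
    | zero => simp
    | add x y hx hy => simp only [map_add, hx, hy]
    | tmul v k =>
      rw [leftAmp_apply, TensorProduct.mapL_tmul, hU, hU]
      exact hFA a k v
  · intro b x
    change TB b (U x) = U (rightAmp (SB b) x)
    induction x with
    | zero => simp
    | add x y hx hy => simp only [map_add, hx, hy]
    | tmul v k =>
      rw [rightAmp_apply, TensorProduct.mapL_tmul, hU, hU]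
      exact hFB b k v

/-- A commuting pair of representations on a nonzero finite-dimensional space contains a tensor
product of two representations. -/
theorem exists_tensor_subrepresentation {H : Type u} [NormedAddCommGroup H]
    [InnerProductSpace ℂ H] [FiniteDimensional ℂ H]
    {TA : MA →ₗ[ℝ] (H →L[ℂ] H)} {TB : MB →ₗ[ℝ] (H →L[ℂ] H)}
    [Nontrivial H] (hA : MA.IsRepresentation TA)
    (hB : MB.IsRepresentation TB) (hAB : CommutingRanges TA TB) :
    ∃ (V : Type u) (_ : NormedAddCommGroup V) (_ : InnerProductSpace ℂ V)
      (_ : FiniteDimensional ℂ V)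
      (W : Type u) (_ : NormedAddCommGroup W) (_ : InnerProductSpace ℂ W)
      (_ : FiniteDimensional ℂ W)
      (SA : MA →ₗ[ℝ] (V →L[ℂ] V)) (SB : MB →ₗ[ℝ] (W →L[ℂ] W))
      (J : V ⊗[ℂ] W →ₗᵢ[ℂ] H), MA.IsRepresentation SA ∧ MB.IsRepresentation SB ∧
      (∀ a x, TA a (J x) = J (leftAmp (SA a) x)) ∧ (∀ b x, TB b (J x) = J (rightAmp (SB b) x)) ∧
      ∃ x, J x ≠ 0 := by
  have : CompleteSpace H := FiniteDimensional.complete ℂ H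
  obtain ⟨V, hV0, hV, hVmin⟩ :=
    exists_minimal_invariant_submodule (fun a : MA => (TA a : H →ₗ[ℂ] H))
  have : Nontrivial V := Submodule.nontrivial_iff_ne_bot.2 hV0
  set SA : MA →ₗ[ℝ] (V →L[ℂ] V) := (compression V.subtypeₗᵢ : OpMap H V) ∘ₗ TA with hSA
  have hSArep : MA.IsRepresentation SA := hA.compression V.subtypeₗᵢ
  have hSAV : ∀ a v, ((SA a v : V) : H) = TA a v := fun a v =>
    apply_compression V.subtypeₗᵢ (X := TA a) (fun v => ⟨⟨_, hV a v v.2⟩, rfl⟩) v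
  have hirr : ∀ U : Submodule ℂ V, (∀ a : MA, ∀ x ∈ U, (SA a : V →ₗ[ℂ] V) x ∈ U) →
      U = ⊥ ∨ U = ⊤ := by
    intro U hU
    rcases hVmin (U.map V.subtype) (Submodule.map_subtype_le V U) (by
      rintro a _ ⟨x, hx, rfl⟩
      exact ⟨SA a x, hU a x hx, hSAV a x⟩) with h | h
    · exact .inl (Submodule.map_injective_of_injective V.injective_subtype
        (h.trans (Submodule.map_bot V.subtype).symm))
    · right
      apply Submodule.map_injective_of_injective V.injective_subtype
      rw [h, Submodule.map_subtype_top]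
  -- The multiplicity space of the irreducible V: all intertwiners from V to H for the A-operators.
  let E : Submodule ℂ (V →ₗ[ℂ] H) :=
    { carrier := {f | ∀ a v, f (SA a v) = TA a (f v)}
      add_mem' := fun {f g} hf hg a v => by
        rw [LinearMap.add_apply, hf a v, hg a v, LinearMap.add_apply, map_add]
      zero_mem' := fun a v => by simp
      smul_mem' := fun c f hf a v => by
        rw [LinearMap.smul_apply, hf a v, LinearMap.smul_apply, map_smul] }
  have hEmem : ∀ f, f ∈ E ↔ ∀ a v, f (SA a v) = TA a (f v) := fun f => Iff.rfl
  obtain ⟨v₀, hv₀⟩ := exists_norm_eq V (zero_le_one' ℝ)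
  have hEin : ∀ (f g : E) (v w : V), inner ℂ (f.1 v) (g.1 w) =
      inner ℂ v w * inner ℂ (f.1 v₀) (g.1 v₀) := by
    intro f g v w
    obtain ⟨c, hc⟩ := exists_inner_intertwiner_eq (S := fun a : MA => (SA a : V →ₗ[ℂ] V))
      (T := fun a : MA => (TA a : H →ₗ[ℂ] H)) (fun a => hSArep.isSymmetric a)
      (fun a => hA.isSymmetric a) hirr f.2 g.2
    rw [hc, hc, inner_self_eq_norm_sq_to_K, hv₀]
    simp [mul_comm]
  -- Evaluation at a fixed unit vector embeds E in H, so its image W inherits an inner product; by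
  -- `hEin` this is the one required on the multiplicity space.
  let ev : E →ₗ[ℂ] H := (LinearMap.applyₗ v₀) ∘ₗ E.subtype
  have hev : ∀ f : E, ev f = f.1 v₀ := fun f => rfl
  have hinj : Function.Injective ev := by
    rw [← LinearMap.ker_eq_bot, LinearMap.ker_eq_bot']
    intro f hf
    refine Subtype.ext (LinearMap.ext fun v => ?_)
    have h := hEin f f v v
    rw [hev] at hf
    rw [hf, inner_zero_left, mul_zero, inner_self_eq_zero] at h
    simpa using h
  let W : Submodule ℂ H := LinearMap.range ev
  let L : E ≃ₗ[ℂ] W := LinearEquiv.ofInjective ev hinj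
  have hLf : ∀ f, ((L f : W) : H) = f.1 v₀ := fun f => LinearEquiv.ofInjective_apply ev f
  have hL : ∀ k : W, (L.symm k).1 v₀ = k := fun k => by
    conv_rhs => rw [← L.apply_symm_apply k]
    rw [hLf]
  -- Commuting ranges enter here: composing an intertwiner with a B-operator gives another
  -- intertwiner.
  have hTB : ∀ (b : MB) (f : E), (TB b : H →ₗ[ℂ] H) ∘ₗ f.1 ∈ E := fun b f => by
    rw [hEmem]
    intro a v
    have h := f.2 a v
    have h2 := congrArg (fun X : H →L[ℂ] H => X (f.1 v)) (hAB a b)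
    simp only [LinearMap.comp_apply, ContinuousLinearMap.coe_coe]
    rw [h]
    exact h2.symm
  have hWinv : ∀ (b : MB) (k : W), TB b k ∈ W := fun b k =>
    ⟨⟨_, hTB b (L.symm k)⟩, by rw [hev]; exact congrArg (TB b) (hL k)⟩
  set SB : MB →ₗ[ℝ] (W →L[ℂ] W) := (compression W.subtypeₗᵢ : OpMap H W) ∘ₗ TB with hSB
  have hSBW : ∀ b k, ((SB b k : W) : H) = TB b k := fun b k =>
    apply_compression W.subtypeₗᵢ (X := TB b) (fun k => ⟨⟨_, hWinv b k⟩, rfl⟩) k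
  have hLSB : ∀ b k v, (L.symm (SB b k)).1 v = TB b ((L.symm k).1 v) := fun b k v => by
    have h : L.symm (SB b k) = ⟨_, hTB b (L.symm k)⟩ := by
      rw [LinearEquiv.symm_apply_eq]
      refine Subtype.ext ?_
      rw [hSBW, hLf]
      exact congrArg (TB b) (hL k).symm
    rw [h]
    rfl
  -- The inclusion of V is an intertwiner sending v₀ to itself, which shows that J is nonzero.
  have hVE : V.subtype ∈ E := (hEmem _).2 fun a v => hSAV a v
  obtain ⟨J, hJ, hJA, hJB⟩ := exists_isometry_of_inner (TA := TA) (TB := TB) (SA := SA) (SB := SB)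
    (E.subtype ∘ₗ (L.symm : W →ₗ[ℂ] E))
    (fun k l v w => (hEin _ _ v w).trans (congrArg (fun c => inner ℂ v w * c)
      (congrArg₂ (inner ℂ) (hL k) (hL l))))
    (fun a k v => ((L.symm k).2 a v).symm) (fun b k v => (hLSB b k v).symm)
  refine ⟨V, inferInstance, inferInstance, inferInstance, W, inferInstance, inferInstance,
    inferInstance, SA, SB, J, hSArep, hB.compression W.subtypeₗᵢ, hJA, hJB,
    v₀ ⊗ₜ L ⟨_, hVE⟩, fun h => ?_⟩
  have h1 : ((E.subtype ∘ₗ (L.symm : W →ₗ[ℂ] E)) (L ⟨_, hVE⟩)) v₀ = 0 := (hJ _ _).symm.trans h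
  have h2 : (v₀ : H) = 0 := by
    simpa using h1
  rw [Submodule.coe_eq_zero] at h2
  rw [h2, norm_zero] at hv₀
  exact zero_ne_one hv₀

end OperatorSystem

/-! ### Finite-dimensional commuting pairs and the pmin bound -/

namespace OperatorSystem

variable {KA KB : Type u}
  [NormedAddCommGroup KA] [InnerProductSpace ℂ KA] [CompleteSpace KA]
  [NormedAddCommGroup KB] [InnerProductSpace ℂ KB] [CompleteSpace KB]
  {MA : OperatorSystem KA} {MB : OperatorSystem KB}

theorem IsRepresentation.apply_mem_orthogonal {K H : Type*} [NormedAddCommGroup K]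
    [InnerProductSpace ℂ K] [CompleteSpace K] {M : OperatorSystem K} [NormedAddCommGroup H]
    [InnerProductSpace ℂ H] {T : M →ₗ[ℝ] (H →L[ℂ] H)} (hT : M.IsRepresentation T)
    {R : Submodule ℂ H} {a : M} (hR : ∀ x ∈ R, T a x ∈ R) {v : H} (hv : v ∈ Rᗮ) : T a v ∈ Rᗮ := by
  rw [Submodule.mem_orthogonal] at hv ⊢
  intro x hx
  exact (hT.isSymmetric a x v).symm.trans (hv _ (hR x hx))

/-- Strong induction on the dimension. A tensor product piece obeys the bound by definition of the
pmin norm, its orthogonal complement by induction, and Pythagoras combines the two. -/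
theorem norm_prodMap_apply_le_pminNorm (z : MA ⊗[ℝ] MB) {H : Type u} [NormedAddCommGroup H]
    [InnerProductSpace ℂ H] [FiniteDimensional ℂ H] {TA : MA →ₗ[ℝ] (H →L[ℂ] H)}
    {TB : MB →ₗ[ℝ] (H →L[ℂ] H)} (hA : MA.IsRepresentation TA) (hB : MB.IsRepresentation TB)
    (hAB : CommutingRanges TA TB) (v : H) : ‖prodMap TA TB z v‖ ≤ pminNorm z * ‖v‖ := by
  induction hn : Module.finrank ℂ H using Nat.strong_induction_on generalizing H with
  | _ n ih =>
  rcases subsingleton_or_nontrivial H with hH | hH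
  · rw [Subsingleton.elim v 0]
    simp
  have : CompleteSpace H := FiniteDimensional.complete ℂ H
  obtain ⟨V, _, _, _, W, _, _, _, SA, SB, J, hSA, hSB, hJA, hJB, x₀, hx₀⟩ :=
    exists_tensor_subrepresentation hA hB hAB
  have : CompleteSpace V := FiniteDimensional.complete ℂ V
  have : CompleteSpace W := FiniteDimensional.complete ℂ W
  set R : Submodule ℂ H := LinearMap.range J.toLinearMap with hR
  have hJR : ∀ x, J x ∈ R := fun x => ⟨x, rfl⟩
  have hRA : ∀ a, ∀ x ∈ R, TA a x ∈ R := by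
    rintro a _ ⟨x, rfl⟩
    exact ⟨_, (hJA a x).symm⟩
  have hRB : ∀ b, ∀ x ∈ R, TB b x ∈ R := by
    rintro b _ ⟨x, rfl⟩
    exact ⟨_, (hJB b x).symm⟩
  set QA : MA →ₗ[ℝ] (Rᗮ →L[ℂ] Rᗮ) := (compression Rᗮ.subtypeₗᵢ : OpMap H Rᗮ) ∘ₗ TA with hQA
  set QB : MB →ₗ[ℝ] (Rᗮ →L[ℂ] Rᗮ) := (compression Rᗮ.subtypeₗᵢ : OpMap H Rᗮ) ∘ₗ TB with hQB
  have hQAc : ∀ a v, ((QA a v : Rᗮ) : H) = TA a v := fun a v =>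
    apply_compression Rᗮ.subtypeₗᵢ (X := TA a)
      (fun v => ⟨⟨_, hA.apply_mem_orthogonal (hRA a) v.2⟩, rfl⟩) v
  have hQBc : ∀ b v, ((QB b v : Rᗮ) : H) = TB b v := fun b v =>
    apply_compression Rᗮ.subtypeₗᵢ (X := TB b)
      (fun v => ⟨⟨_, hB.apply_mem_orthogonal (hRB b) v.2⟩, rfl⟩) v
  have hQAB : CommutingRanges QA QB := fun a b => by
    refine ContinuousLinearMap.ext fun v => Subtype.ext ?_
    change ((QA a (QB b v) : Rᗮ) : H) = (QB b (QA a v) : Rᗮ)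
    rw [hQAc, hQBc, hQBc, hQAc]
    exact congrArg (fun X : H →L[ℂ] H => X v) (hAB a b)
  have hlt : Module.finrank ℂ Rᗮ < n := by
    rw [← hn]
    refine Submodule.finrank_lt fun htop => hx₀ ?_
    have h1 : J x₀ ∈ Rᗮ := htop ▸ Submodule.mem_top
    exact inner_self_eq_zero.1 ((Submodule.mem_orthogonal R _).1 h1 _ (hJR x₀))
  obtain ⟨y, ⟨x, hxy⟩, w, hw, rfl⟩ := R.exists_add_mem_mem_orthogonal v
  have hxy' : J x = y := hxy
  have h1 : prodMap TA TB z y = J (algTensorMap SA SB z x) := by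
    rw [← hxy']
    exact prodMap_apply_intertwine J.toLinearMap hJA hJB z x
  have h2 : prodMap TA TB z w = ((prodMap QA QB z ⟨w, hw⟩ : Rᗮ) : H) :=
    prodMap_apply_intertwine (SA := QA) (SB := QB) Rᗮ.subtype (fun a v => (hQAc a v).symm)
      (fun b v => (hQBc b v).symm) z ⟨w, hw⟩
  have h3 : ‖prodMap TA TB z y‖ ≤ pminNorm z * ‖y‖ := by
    rw [h1, J.norm_map, ← hxy', J.norm_map]
    exact (norm_algTensorMap_apply_le SA SB z x).trans
      (mul_le_mul_of_nonneg_right (norm_tensorMap_le_pminNorm z hSA hSB) (norm_nonneg _))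
  have h4 : ‖prodMap TA TB z w‖ ≤ pminNorm z * ‖w‖ := by
    rw [h2]
    exact ih _ hlt (hA.compression Rᗮ.subtypeₗᵢ) (hB.compression Rᗮ.subtypeₗᵢ) hQAB ⟨w, hw⟩ rfl
  have h5 : inner ℂ y w = 0 := (Submodule.mem_orthogonal R w).1 hw y ⟨x, hxy⟩
  -- Both summands are invariant, so the images stay orthogonal.
  have h6 : inner ℂ (prodMap TA TB z y) (prodMap TA TB z w) = 0 := by
    rw [h1, h2]
    exact (Submodule.mem_orthogonal R _).1 (Subtype.prop _) _ (hJR _)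
  have h7 := norm_add_sq_eq_norm_sq_add_norm_sq_of_inner_eq_zero y w h5
  have h8 := norm_add_sq_eq_norm_sq_add_norm_sq_of_inner_eq_zero _ _ h6
  have h9 := pminNorm_nonneg z
  rw [map_add]
  refine abs_le_of_sq_le_sq' ?_ (mul_nonneg h9 (norm_nonneg _)) |>.2
  have h10 := mul_self_le_mul_self (norm_nonneg _) h3
  have h11 := mul_self_le_mul_self (norm_nonneg _) h4
  calc ‖prodMap TA TB z y + prodMap TA TB z w‖ ^ 2 ≤ pminNorm z ^ 2 * (‖y‖ * ‖y‖ + ‖w‖ * ‖w‖) := by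
        rw [pow_two, h8]; linarith
    _ = (pminNorm z * ‖y + w‖) ^ 2 := by rw [← h7]; ring

theorem norm_prodMap_le_pminNorm (z : MA ⊗[ℝ] MB) {H : Type u} [NormedAddCommGroup H]
    [InnerProductSpace ℂ H] [FiniteDimensional ℂ H] {TA : MA →ₗ[ℝ] (H →L[ℂ] H)}
    {TB : MB →ₗ[ℝ] (H →L[ℂ] H)} (hA : MA.IsRepresentation TA) (hB : MB.IsRepresentation TB)
    (hAB : CommutingRanges TA TB) : ‖prodMap TA TB z‖ ≤ pminNorm z :=
  ContinuousLinearMap.opNorm_le_bound _ (pminNorm_nonneg z)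
    (norm_prodMap_apply_le_pminNorm z hA hB hAB)

/-- The vector functional `z ↦ ⟪(TA · TB)(z) v, v⟫`. -/
noncomputable def vectorFunctional {H : Type*} [NormedAddCommGroup H] [InnerProductSpace ℂ H]
    (TA : MA →ₗ[ℝ] (H →L[ℂ] H)) (TB : MB →ₗ[ℝ] (H →L[ℂ] H)) (v : H) : (MA ⊗[ℝ] MB) →ₗ[ℝ] ℝ where
  toFun z := (inner ℂ (prodMap TA TB z v) v).re
  map_add' z w := by rw [map_add, add_apply, inner_add_left, Complex.add_re]
  map_smul' c z := by
    rw [map_smul, smul_apply, ← Complex.coe_smul, inner_smul_left]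
    simp

theorem isPmaxState_vectorFunctional {H : Type u} [NormedAddCommGroup H] [InnerProductSpace ℂ H]
    [CompleteSpace H] {TA : MA →ₗ[ℝ] (H →L[ℂ] H)} {TB : MB →ₗ[ℝ] (H →L[ℂ] H)}
    (hA : MA.IsRepresentation TA) (hB : MB.IsRepresentation TB)
    (hAB : CommutingRanges TA TB) {v : H} (hv : ‖v‖ = 1) :
    IsPmaxState (vectorFunctional TA TB v) where
  nonneg z hz := (Complex.nonneg_iff.1
    ((ContinuousLinearMap.nonneg_iff_forall_inner _).1 (hz H TA TB hA hB hAB) v)).1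
  map_unit := by
    change (inner ℂ (prodMap TA TB (MA.unit ⊗ₜ[ℝ] MB.unit) v) v).re = 1
    rw [prodMap_unit hA hB, one_apply_eq_self, inner_self_eq_norm_sq_to_K, hv]
    simp

/-- Finite-dimensional approximability of all states bounds the p-maximal norm by the p-minimal
norm. -/
theorem pmaxNorm_le_pminNorm_of_approx (z : MA ⊗[ℝ] MB)
    (h : ∀ ω : (MA ⊗[ℝ] MB) →ₗ[ℝ] ℝ, IsPmaxState ω → ∀ ε : ℝ, 0 < ε →
        ∃ (H : Type u) (_ : NormedAddCommGroup H) (_ : InnerProductSpace ℂ H)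
          (_ : FiniteDimensional ℂ H)
          (TA : MA →ₗ[ℝ] (H →L[ℂ] H)) (TB : MB →ₗ[ℝ] (H →L[ℂ] H))
          (φ : (H →L[ℂ] H) →ₗ[ℂ] ℂ),
          MA.IsRepresentation TA ∧ MB.IsRepresentation TB ∧
          CommutingRanges TA TB ∧ IsOperatorState φ ∧
          ‖(ω z : ℂ) - φ (prodMap TA TB z)‖ < ε) : pmaxNorm z ≤ pminNorm z := by
  have hω : ∀ ω : (MA ⊗[ℝ] MB) →ₗ[ℝ] ℝ, IsPmaxState ω → |ω z| ≤ pminNorm z := by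
    intro ω hω
    refine le_of_forall_pos_le_add fun ε hε => ?_
    obtain ⟨H, _, _, _, TA, TB, φ, hA, hB, hAB, hφ, hlt⟩ := h ω hω ε hε
    have h1 := hφ.norm_apply_le (isSymmetric_prodMap hA hB hAB z)
    have h2 := norm_prodMap_le_pminNorm z hA hB hAB
    calc |ω z| = ‖(ω z : ℂ)‖ := by rw [Complex.norm_real, Real.norm_eq_abs]
      _ ≤ ‖φ (prodMap TA TB z)‖ + ‖(ω z : ℂ) - φ (prodMap TA TB z)‖ := norm_le_norm_add_norm_sub' _ _
      _ ≤ pminNorm z + ε := add_le_add (h1.trans h2) hlt.le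
  refine Real.sSup_le ?_ (pminNorm_nonneg z)
  intro r hr
  obtain ⟨H, _, _, _, TA, TB, hA, hB, hAB, rfl⟩ := hr
  refine ContinuousLinearMap.norm_le_of_isSymmetric (isSymmetric_prodMap hA hB hAB z)
    (pminNorm_nonneg z) fun v => ?_
  rcases eq_or_ne v 0 with rfl | hv
  · simp
  have hv' : (‖v‖ : ℝ) ≠ 0 := norm_ne_zero_iff.2 hv
  -- Normalizing v turns its functional into a pmax state, to which the bound on states applies; the
  -- factor ‖v‖² is restored below.
  have h1 := hω _ (isPmaxState_vectorFunctional hA hB hAB (v := ((‖v‖⁻¹ : ℝ) : ℂ) • v)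
    (by rw [norm_smul, Complex.norm_real, norm_inv, norm_norm, inv_mul_cancel₀ hv']))
  have h2 : vectorFunctional TA TB (((‖v‖⁻¹ : ℝ) : ℂ) • v) z =
      (‖v‖⁻¹ * ‖v‖⁻¹) * (inner ℂ (prodMap TA TB z v) v).re := by
    change (inner ℂ (prodMap TA TB z _) _).re = _
    rw [map_smul, inner_smul_left, inner_smul_right, Complex.conj_ofReal, ← mul_assoc,
      ← Complex.ofReal_mul, Complex.re_ofReal_mul]
  rw [h2, abs_mul, abs_of_nonneg (mul_self_nonneg _)] at h1
  calc |(inner ℂ (prodMap TA TB z v) v).re|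
      = (‖v‖⁻¹ * ‖v‖⁻¹ * |(inner ℂ (prodMap TA TB z v) v).re|) * ‖v‖ ^ 2 := by field_simp
    _ ≤ pminNorm z * ‖v‖ ^ 2 := mul_le_mul_of_nonneg_right h1 (sq_nonneg _)

end OperatorSystem

/-- The normalized vector state of `v`. -/
noncomputable def vectorState {H : Type*} [NormedAddCommGroup H] [InnerProductSpace ℂ H] (v : H) :
    (H →L[ℂ] H) →ₗ[ℂ] ℂ where
  toFun X := (((‖v‖ ^ 2)⁻¹ : ℝ) : ℂ) * inner ℂ v (X v)
  map_add' X Y := by rw [add_apply, inner_add_right, mul_add]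
  map_smul' c X := by
    rw [smul_apply, inner_smul_right, RingHom.id_apply, smul_eq_mul]
    ring

theorem vectorState_apply {H : Type*} [NormedAddCommGroup H] [InnerProductSpace ℂ H] (v : H)
    (X : H →L[ℂ] H) : vectorState v X = (((‖v‖ ^ 2)⁻¹ : ℝ) : ℂ) * inner ℂ v (X v) := rfl

theorem isOperatorState_vectorState {H : Type*} [NormedAddCommGroup H] [InnerProductSpace ℂ H]
    {v : H} (hv : v ≠ 0) : IsOperatorState (vectorState v) where
  nonneg X hX := by
    rw [ContinuousLinearMap.nonneg_iff_isPositive] at hX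
    exact mul_nonneg (Complex.zero_le_real.2 (inv_nonneg.2 (sq_nonneg _))) (hX.inner_nonneg_right v)
  map_one := by
    have h : (‖v‖ : ℂ) ≠ 0 := by simpa using hv
    rw [vectorState_apply, one_apply_eq_self, inner_self_eq_norm_sq_to_K]
    simp [h]

namespace OperatorSystem

/-! ### Direct sums of commuting pairs -/

section DirectSum

variable {H₁ H₂ G : Type*} [NormedAddCommGroup H₁] [InnerProductSpace ℂ H₁] [CompleteSpace H₁]
  [NormedAddCommGroup H₂] [InnerProductSpace ℂ H₂] [CompleteSpace H₂]
  [NormedAddCommGroup G] [InnerProductSpace ℂ G] [CompleteSpace G]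

open ContinuousLinearMap in
/-- The corner embedding `X ↦ J X J†` along an isometry `J`. -/
noncomputable def corner (J : H₁ →ₗᵢ[ℂ] G) : OpMap H₁ G :=
  OpMap.ofComplex
    { toFun := fun X => J.toContinuousLinearMap ∘L X ∘L adjoint J.toContinuousLinearMap
      map_add' := fun X Y => by ext; simp
      map_smul' := fun c X => by ext; simp }

theorem corner_apply (J : H₁ →ₗᵢ[ℂ] G) (X : H₁ →L[ℂ] H₁) (g : G) :
    corner J X g = J (X (ContinuousLinearMap.adjoint J.toContinuousLinearMap g)) := rfl

theorem corner_nonneg (J : H₁ →ₗᵢ[ℂ] G) {X : H₁ →L[ℂ] H₁} (hX : 0 ≤ X) : 0 ≤ corner J X := by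
  rw [ContinuousLinearMap.nonneg_iff_forall_inner] at hX ⊢
  intro g
  have h : inner ℂ (corner J X g) g =
      inner ℂ (X (ContinuousLinearMap.adjoint J.toContinuousLinearMap g))
        (ContinuousLinearMap.adjoint J.toContinuousLinearMap g) := by
    rw [ContinuousLinearMap.adjoint_inner_right, corner_apply]
    rfl
  rw [h]
  exact hX _

theorem corner_mul (J : H₁ →ₗᵢ[ℂ] G) (X Y : H₁ →L[ℂ] H₁) :
    corner J (X * Y) = corner J X * corner J Y := by
  ext g
  rw [mul_apply_eq_comp, corner_apply, corner_apply, corner_apply, adjoint_apply_isometry,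
    mul_apply_eq_comp]

theorem adjoint_apply_of_orthogonal {H₂ : Type*} [NormedAddCommGroup H₂] [InnerProductSpace ℂ H₂]
    {J₁ : H₁ →ₗᵢ[ℂ] G} {J₂ : H₂ →ₗᵢ[ℂ] G}
    (h : ∀ x y, inner ℂ (J₁ x) (J₂ y) = 0) (y : H₂) :
    ContinuousLinearMap.adjoint J₁.toContinuousLinearMap (J₂ y) = 0 := by
  refine ext_inner_left ℂ fun x => ?_
  rw [ContinuousLinearMap.adjoint_inner_right, inner_zero_right]
  exact h x y

theorem corner_mul_corner_of_orthogonal {J₁ : H₁ →ₗᵢ[ℂ] G} {J₂ : H₂ →ₗᵢ[ℂ] G}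
    (h : ∀ x y, inner ℂ (J₁ x) (J₂ y) = 0) (X : H₁ →L[ℂ] H₁) (Y : H₂ →L[ℂ] H₂) :
    corner J₁ X * corner J₂ Y = 0 := by
  ext g
  rw [mul_apply_eq_comp, corner_apply, corner_apply, adjoint_apply_of_orthogonal h, map_zero,
    map_zero, zero_apply]

theorem compression_corner (J : H₁ →ₗᵢ[ℂ] G) (X : H₁ →L[ℂ] H₁) :
    compressionₗ J (corner J X) = X := by
  ext x
  change ContinuousLinearMap.adjoint J.toContinuousLinearMap (corner J X (J x)) = X x
  rw [corner_apply, adjoint_apply_isometry, adjoint_apply_isometry]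

theorem compression_corner_of_orthogonal {J₁ : H₁ →ₗᵢ[ℂ] G} {J₂ : H₂ →ₗᵢ[ℂ] G}
    (h : ∀ x y, inner ℂ (J₁ x) (J₂ y) = 0) (Y : H₂ →L[ℂ] H₂) :
    compressionₗ J₁ (corner J₂ Y) = 0 := by
  ext x
  change ContinuousLinearMap.adjoint J₁.toContinuousLinearMap (corner J₂ Y (J₁ x)) = 0
  rw [corner_apply, adjoint_apply_of_orthogonal h]

theorem corner_one_add_corner_one {J₁ : H₁ →ₗᵢ[ℂ] G} {J₂ : H₂ →ₗᵢ[ℂ] G}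
    (h : ∀ x y, inner ℂ (J₁ x) (J₂ y) = 0) (hspan : ∀ g, ∃ x y, g = J₁ x + J₂ y) :
    corner J₁ 1 + corner J₂ 1 = 1 := by
  have h' : ∀ y x, inner ℂ (J₂ y) (J₁ x) = 0 := fun y x => inner_eq_zero_symm.1 (h x y)
  ext g
  obtain ⟨x, y, rfl⟩ := hspan g
  simp only [add_apply, corner_apply, map_add, adjoint_apply_isometry, one_apply_eq_self,
    adjoint_apply_of_orthogonal h, adjoint_apply_of_orthogonal h',
    map_zero, add_zero, zero_add]

variable {KA KB : Type*}
  [NormedAddCommGroup KA] [InnerProductSpace ℂ KA] [CompleteSpace KA]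
  [NormedAddCommGroup KB] [InnerProductSpace ℂ KB] [CompleteSpace KB]
  {MA : OperatorSystem KA} {MB : OperatorSystem KB}

/-- The direct sum of two linear maps into operator algebras. -/
noncomputable def directSum (J₁ : H₁ →ₗᵢ[ℂ] G) (J₂ : H₂ →ₗᵢ[ℂ] G)
    (T₁ : MA →ₗ[ℝ] (H₁ →L[ℂ] H₁)) (T₂ : MA →ₗ[ℝ] (H₂ →L[ℂ] H₂)) : MA →ₗ[ℝ] (G →L[ℂ] G) :=
  corner J₁ ∘ₗ T₁ + corner J₂ ∘ₗ T₂

theorem directSum_apply (J₁ : H₁ →ₗᵢ[ℂ] G) (J₂ : H₂ →ₗᵢ[ℂ] G)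
    (T₁ : MA →ₗ[ℝ] (H₁ →L[ℂ] H₁)) (T₂ : MA →ₗ[ℝ] (H₂ →L[ℂ] H₂)) (a : MA) :
    directSum J₁ J₂ T₁ T₂ a = corner J₁ (T₁ a) + corner J₂ (T₂ a) := rfl

theorem IsRepresentation.directSum {J₁ : H₁ →ₗᵢ[ℂ] G} {J₂ : H₂ →ₗᵢ[ℂ] G}
    (h : ∀ x y, inner ℂ (J₁ x) (J₂ y) = 0) (hspan : ∀ g, ∃ x y, g = J₁ x + J₂ y)
    {T₁ : MA →ₗ[ℝ] (H₁ →L[ℂ] H₁)} {T₂ : MA →ₗ[ℝ] (H₂ →L[ℂ] H₂)} (h₁ : MA.IsRepresentation T₁)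
    (h₂ : MA.IsRepresentation T₂) : MA.IsRepresentation (directSum J₁ J₂ T₁ T₂) where
  nonneg a ha := by
    have k₁ := corner_nonneg J₁ (h₁.nonneg a ha)
    have k₂ := corner_nonneg J₂ (h₂.nonneg a ha)
    rw [ContinuousLinearMap.nonneg_iff_isPositive] at k₁ k₂ ⊢
    exact k₁.add k₂
  map_unit := by
    rw [directSum_apply, h₁.map_unit, h₂.map_unit, corner_one_add_corner_one h hspan]

theorem directSum_mul {J₁ : H₁ →ₗᵢ[ℂ] G} {J₂ : H₂ →ₗᵢ[ℂ] G}
    (h : ∀ x y, inner ℂ (J₁ x) (J₂ y) = 0) (X₁ Y₁ : H₁ →L[ℂ] H₁) (X₂ Y₂ : H₂ →L[ℂ] H₂) :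
    (corner J₁ X₁ + corner J₂ X₂) * (corner J₁ Y₁ + corner J₂ Y₂) =
      corner J₁ (X₁ * Y₁) + corner J₂ (X₂ * Y₂) := by
  have h' : ∀ y x, inner ℂ (J₂ y) (J₁ x) = 0 := fun y x => inner_eq_zero_symm.1 (h x y)
  rw [mul_add, add_mul, add_mul, corner_mul, corner_mul, corner_mul_corner_of_orthogonal h,
    corner_mul_corner_of_orthogonal h', zero_add, add_zero]

theorem CommutingRanges.directSum {J₁ : H₁ →ₗᵢ[ℂ] G} {J₂ : H₂ →ₗᵢ[ℂ] G}
    (h : ∀ x y, inner ℂ (J₁ x) (J₂ y) = 0)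
    {A₁ : MA →ₗ[ℝ] (H₁ →L[ℂ] H₁)} {A₂ : MA →ₗ[ℝ] (H₂ →L[ℂ] H₂)}
    {B₁ : MB →ₗ[ℝ] (H₁ →L[ℂ] H₁)} {B₂ : MB →ₗ[ℝ] (H₂ →L[ℂ] H₂)}
    (h₁ : CommutingRanges A₁ B₁) (h₂ : CommutingRanges A₂ B₂) :
    CommutingRanges (directSum J₁ J₂ A₁ A₂) (directSum J₁ J₂ B₁ B₂) := fun a b => by
  have k₁ : A₁ a * B₁ b = B₁ b * A₁ a := h₁ a b
  have k₂ : A₂ a * B₂ b = B₂ b * A₂ a := h₂ a b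
  rw [commute_iff_eq, directSum_apply, directSum_apply, directSum_mul h, directSum_mul h, k₁, k₂]

theorem prodMap_directSum {J₁ : H₁ →ₗᵢ[ℂ] G} {J₂ : H₂ →ₗᵢ[ℂ] G}
    (h : ∀ x y, inner ℂ (J₁ x) (J₂ y) = 0)
    {A₁ : MA →ₗ[ℝ] (H₁ →L[ℂ] H₁)} {A₂ : MA →ₗ[ℝ] (H₂ →L[ℂ] H₂)}
    {B₁ : MB →ₗ[ℝ] (H₁ →L[ℂ] H₁)} {B₂ : MB →ₗ[ℝ] (H₂ →L[ℂ] H₂)} (z : MA ⊗[ℝ] MB) :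
    prodMap (directSum J₁ J₂ A₁ A₂) (directSum J₁ J₂ B₁ B₂) z =
      corner J₁ (prodMap A₁ B₁ z) + corner J₂ (prodMap A₂ B₂ z) := by
  induction z with
  | zero => simp
  | tmul a b => exact directSum_mul h _ _ _ _
  | add z w hz hw =>
    simp only [map_add, hz, hw]
    abel

theorem exists_orthogonal_isometries (H₁ H₂ : Type u) [NormedAddCommGroup H₁]
    [InnerProductSpace ℂ H₁] [FiniteDimensional ℂ H₁] [NormedAddCommGroup H₂]
    [InnerProductSpace ℂ H₂] [FiniteDimensional ℂ H₂] :
    ∃ (G : Type u) (_ : NormedAddCommGroup G) (_ : InnerProductSpace ℂ G)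
      (_ : FiniteDimensional ℂ G) (J₁ : H₁ →ₗᵢ[ℂ] G) (J₂ : H₂ →ₗᵢ[ℂ] G),
      (∀ x y, inner ℂ (J₁ x) (J₂ y) = 0) ∧ ∀ g, ∃ x y, g = J₁ x + J₂ y := by
  let e : (H₁ × H₂) ≃ₗ[ℂ] WithLp 2 (H₁ × H₂) := (WithLp.linearEquiv 2 ℂ (H₁ × H₂)).symm
  have hfd : FiniteDimensional ℂ (WithLp 2 (H₁ × H₂)) := e.finiteDimensional
  have he : ∀ x y, inner ℂ (e x) (e y) = inner ℂ x.1 y.1 + inner ℂ x.2 y.2 := fun x y =>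
    WithLp.prod_inner_apply _ _
  refine ⟨WithLp 2 (H₁ × H₂), inferInstance, inferInstance, hfd,
    (e.toLinearMap ∘ₗ LinearMap.inl ℂ H₁ H₂).isometryOfInner fun x y => (he _ _).trans (by simp),
    (e.toLinearMap ∘ₗ LinearMap.inr ℂ H₁ H₂).isometryOfInner fun x y => (he _ _).trans (by simp),
    fun x y => (he _ _).trans (by simp), fun g => ⟨(e.symm g).1, (e.symm g).2, ?_⟩⟩
  change g = e ((e.symm g).1, 0) + e (0, (e.symm g).2)
  rw [← map_add]
  simp

end DirectSum

/-! ### Approximating a state when the norms agree -/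

section Approximation

variable {KA KB : Type u}
  [NormedAddCommGroup KA] [InnerProductSpace ℂ KA] [CompleteSpace KA]
  [NormedAddCommGroup KB] [InnerProductSpace ℂ KB] [CompleteSpace KB]
  {MA : OperatorSystem KA} {MB : OperatorSystem KB}

/-- `t` is the value at `z` of a state on a finite-dimensional pair of commuting representations. -/
def IsFiniteDimensionalValue (z : MA ⊗[ℝ] MB) (t : ℝ) : Prop :=
  ∃ (H : Type u) (_ : NormedAddCommGroup H) (_ : InnerProductSpace ℂ H)
    (_ : FiniteDimensional ℂ H)
    (TA : MA →ₗ[ℝ] (H →L[ℂ] H)) (TB : MB →ₗ[ℝ] (H →L[ℂ] H))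
    (φ : (H →L[ℂ] H) →ₗ[ℂ] ℂ),
    MA.IsRepresentation TA ∧ MB.IsRepresentation TB ∧
    CommutingRanges TA TB ∧ IsOperatorState φ ∧ φ (prodMap TA TB z) = (t : ℂ)

theorem IsFiniteDimensionalValue.of_neg {z : MA ⊗[ℝ] MB} {t : ℝ}
    (h : IsFiniteDimensionalValue ((-1 : ℝ) • z) t) : IsFiniteDimensionalValue z (-t) := by
  obtain ⟨H, _, _, _, TA, TB, φ, hA, hB, hAB, hφ, ht⟩ := h
  refine ⟨H, _, _, ‹_›, TA, TB, φ, hA, hB, hAB, hφ, ?_⟩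
  rw [map_smul, neg_one_smul, map_neg] at ht
  rw [Complex.ofReal_neg, ← ht, neg_neg]

/-- On the direct sum of the two pairs, compress to each summand and mix the two states with weights
c and 1 − c. -/
theorem IsFiniteDimensionalValue.convex {z : MA ⊗[ℝ] MB} {s t c : ℝ}
    (hs : IsFiniteDimensionalValue z s) (ht : IsFiniteDimensionalValue z t) (h0 : 0 ≤ c)
    (h1 : c ≤ 1) : IsFiniteDimensionalValue z (c * s + (1 - c) * t) := by
  obtain ⟨H₁, _, _, _, A₁, B₁, φ₁, hA₁, hB₁, hAB₁, hφ₁, hs⟩ := hs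
  obtain ⟨H₂, _, _, _, A₂, B₂, φ₂, hA₂, hB₂, hAB₂, hφ₂, ht⟩ := ht
  obtain ⟨G, _, _, _, J₁, J₂, h, hspan⟩ := exists_orthogonal_isometries H₁ H₂
  have h' : ∀ y x, inner ℂ (J₂ y) (J₁ x) = 0 := fun y x => inner_eq_zero_symm.1 (h x y)
  have : CompleteSpace H₁ := FiniteDimensional.complete ℂ H₁
  have : CompleteSpace H₂ := FiniteDimensional.complete ℂ H₂
  have : CompleteSpace G := FiniteDimensional.complete ℂ G
  have hc0 : (0 : ℂ) ≤ (c : ℂ) := Complex.zero_le_real.2 h0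
  have hc1 : (0 : ℂ) ≤ ((1 - c : ℝ) : ℂ) := Complex.zero_le_real.2 (sub_nonneg.2 h1)
  refine ⟨G, _, _, ‹_›, directSum J₁ J₂ A₁ A₂, directSum J₁ J₂ B₁ B₂,
    (c : ℂ) • (φ₁ ∘ₗ compressionₗ J₁) + ((1 - c : ℝ) : ℂ) • (φ₂ ∘ₗ compressionₗ J₂),
    hA₁.directSum h hspan hA₂, hB₁.directSum h hspan hB₂, hAB₁.directSum h hAB₂, ⟨?_, ?_⟩, ?_⟩
  · intro X hX
    exact add_nonneg (mul_nonneg hc0 (hφ₁.nonneg _ (compression_nonneg J₁ hX)))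
      (mul_nonneg hc1 (hφ₂.nonneg _ (compression_nonneg J₂ hX)))
  · have k₁ : φ₁ (compressionₗ J₁ 1) = 1 := (congrArg φ₁ (compression_one J₁)).trans hφ₁.map_one
    have k₂ : φ₂ (compressionₗ J₂ 1) = 1 := (congrArg φ₂ (compression_one J₂)).trans hφ₂.map_one
    simp only [LinearMap.add_apply, LinearMap.smul_apply, LinearMap.comp_apply, k₁, k₂]
    simp
  · rw [prodMap_directSum h]
    simp only [LinearMap.add_apply, LinearMap.smul_apply, LinearMap.comp_apply, map_add,
      compression_corner, compression_corner_of_orthogonal h, compression_corner_of_orthogonal h',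
      hs, ht]
    simp

/-- The element `pmaxNorm z`·(1 ⊗ 1) − z is pmax-positive. -/
theorem IsPmaxState.le_pmaxNorm {ω : (MA ⊗[ℝ] MB) →ₗ[ℝ] ℝ} (hω : IsPmaxState ω)
    (z : MA ⊗[ℝ] MB) : ω z ≤ pmaxNorm z := by
  have h := hω.nonneg (pmaxNorm z • (MA.unit ⊗ₜ[ℝ] MB.unit) + (-1 : ℝ) • z) (by
    intro H _ _ _ TA TB hA hB hAB
    rw [map_add, map_smul, map_smul, prodMap_unit hA hB, neg_one_smul, ← sub_eq_add_neg]
    exact ContinuousLinearMap.norm_smul_one_sub_nonneg (isSymmetric_prodMap hA hB hAB z)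
      (norm_prodMap_le_pmaxNorm z hA hB hAB))
  rw [map_add, map_smul, map_smul, hω.map_unit, smul_eq_mul, mul_one, neg_one_smul] at h
  linarith

theorem pmaxNorm_neg (z : MA ⊗[ℝ] MB) : pmaxNorm ((-1 : ℝ) • z) = pmaxNorm z := by
  unfold pmaxNorm
  simp only [map_smul, neg_one_smul, norm_neg]

theorem tensorMap_smul_unit_add {HA HB : Type*} [NormedAddCommGroup HA] [InnerProductSpace ℂ HA]
    [NormedAddCommGroup HB] [InnerProductSpace ℂ HB]
    [CompleteSpace HA] [CompleteSpace HB]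
    {TA : MA →ₗ[ℝ] (HA →L[ℂ] HA)} {TB : MB →ₗ[ℝ] (HB →L[ℂ] HB)}
    (hA : MA.IsRepresentation TA) (hB : MB.IsRepresentation TB) (c : ℝ) (z : MA ⊗[ℝ] MB) :
    tensorMap TA TB (c • (MA.unit ⊗ₜ[ℝ] MB.unit) + z) = c • 1 + tensorMap TA TB z := by
  rw [tensorMap_eq_prodMap, tensorMap_eq_prodMap, map_add, map_smul]
  congr 2
  exact prodMap_unit hA.leftAmp.completionMap hB.rightAmp.completionMap

/-- A state on the p-maximal tensor product is dominated by vector functionals of tensor product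
representations if the two norms agree. -/
theorem exists_lt_inner_algTensorMap (h : ∀ z : MA ⊗[ℝ] MB, pminNorm z = pmaxNorm z)
    {ω : (MA ⊗[ℝ] MB) →ₗ[ℝ] ℝ} (hω : IsPmaxState ω) (z : MA ⊗[ℝ] MB) {δ : ℝ} (hδ : 0 < δ) :
    ∃ (HA : Type u) (_ : NormedAddCommGroup HA) (_ : InnerProductSpace ℂ HA)
      (_ : CompleteSpace HA) (HB : Type u) (_ : NormedAddCommGroup HB)
      (_ : InnerProductSpace ℂ HB) (_ : CompleteSpace HB)
      (TA : MA →ₗ[ℝ] (HA →L[ℂ] HA)) (TB : MB →ₗ[ℝ] (HB →L[ℂ] HB)) (v : HA ⊗[ℂ] HB),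
      MA.IsRepresentation TA ∧ MB.IsRepresentation TB ∧
        (ω z - δ) * ‖v‖ ^ 2 < (inner ℂ (algTensorMap TA TB z v) v).re := by
  by_contra! hcon
  -- This shift makes c·1 + (TA ⊗ TB)(z) positive, so its norm is governed by upper bounds on the
  -- form alone. It also makes the proposed bound c + ω(z) − δ nonnegative.
  set c := pmaxNorm z + δ with hc
  have h1 : -ω z ≤ pmaxNorm z := by
    have h2 := hω.le_pmaxNorm ((-1 : ℝ) • z)
    rwa [map_smul, neg_one_smul, pmaxNorm_neg] at h2
  have hr : 0 ≤ c + (ω z - δ) := by rw [hc]; linarith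
  have h2 := hω.le_pmaxNorm (c • (MA.unit ⊗ₜ[ℝ] MB.unit) + z)
  rw [map_add, map_smul, hω.map_unit, smul_eq_mul, mul_one, ← h] at h2
  have h3 : pminNorm (c • (MA.unit ⊗ₜ[ℝ] MB.unit) + z) ≤ c + (ω z - δ) := by
    refine Real.sSup_le ?_ hr
    intro r hr'
    obtain ⟨HA, _, _, _, HB, _, _, _, TA, TB, hA, hB, rfl⟩ := hr'
    have hs := isSymmetric_tensorMap hA hB
    have hn : ‖tensorMap TA TB z‖ ≤ c :=
      (norm_tensorMap_le_pmaxNorm z hA hB).trans (by rw [hc]; linarith)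
    refine ContinuousLinearMap.norm_le_of_isSymmetric (hs _) hr fun v => ?_
    rw [tensorMap_smul_unit_add hA hB]
    have h4 := (ContinuousLinearMap.nonneg_iff_forall_inner _).1
      (ContinuousLinearMap.norm_smul_one_add_nonneg (hs z) hn) v
    rw [abs_of_nonneg (Complex.nonneg_iff.1 h4).1, add_apply, inner_add_left, Complex.add_re,
      ContinuousLinearMap.re_inner_real_smul_one, add_mul]
    suffices (inner ℂ (tensorMap TA TB z v) v).re ≤ (ω z - δ) * ‖v‖ ^ 2 by linarith
    -- The inequality is closed in v, so the negated claim, which concerns only algebraic tensors,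
    -- suffices.
    refine UniformSpace.Completion.induction_on v ?_ fun w => ?_
    · refine isClosed_le ?_ ?_ <;> fun_prop
    · rw [tensorMap_coe, UniformSpace.Completion.inner_coe, UniformSpace.Completion.norm_coe]
      exact hcon HA _ _ ‹_› HB _ _ ‹_› TA TB w hA hB
  linarith

theorem inner_algTensorMap_compression {HA HB V W : Type*} [NormedAddCommGroup HA]
    [InnerProductSpace ℂ HA] [CompleteSpace HA] [NormedAddCommGroup HB] [InnerProductSpace ℂ HB]
    [CompleteSpace HB] [NormedAddCommGroup V] [InnerProductSpace ℂ V] [CompleteSpace V]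
    [NormedAddCommGroup W] [InnerProductSpace ℂ W] [CompleteSpace W]
    (TA : MA →ₗ[ℝ] (HA →L[ℂ] HA)) (TB : MB →ₗ[ℝ] (HB →L[ℂ] HB)) (J₁ : V →ₗᵢ[ℂ] HA)
    (J₂ : W →ₗᵢ[ℂ] HB) (z : MA ⊗[ℝ] MB) (x y : V ⊗[ℂ] W) :
    inner ℂ (algTensorMap (compression J₁ ∘ₗ TA) (compression J₂ ∘ₗ TB) z x) y =
      inner ℂ (algTensorMap TA TB z (TensorProduct.mapIsometry J₁ J₂ x))
        (TensorProduct.mapIsometry J₁ J₂ y) := by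
  induction z with
  | zero => simp
  | add z w hz hw => simp only [map_add, add_apply, inner_add_left, hz, hw]
  | tmul a b =>
    rw [algTensorMap_tmul, algTensorMap_tmul]
    induction x with
    | zero => simp
    | add x x' hx hx' => simp only [map_add, inner_add_left, hx, hx']
    | tmul v w =>
      induction y with
      | zero => simp
      | add x x' hx hx' => simp only [map_add, inner_add_right, hx, hx']
      | tmul v' w' =>
        simp only [TensorProduct.mapIsometry_apply, TensorProduct.map_tmul,
          TensorProduct.mapL_tmul, TensorProduct.inner_tmul, LinearMap.comp_apply,
          inner_compression_left]
        rfl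

/-- An algebraic tensor involves finitely many vectors of each factor. This is why the vector is
sought before completion. -/
theorem exists_mapIsometry_eq {HA HB : Type u} [NormedAddCommGroup HA]
    [InnerProductSpace ℂ HA] [NormedAddCommGroup HB] [InnerProductSpace ℂ HB]
    (v : HA ⊗[ℂ] HB) :
    ∃ (V : Type u) (_ : NormedAddCommGroup V) (_ : InnerProductSpace ℂ V)
      (_ : FiniteDimensional ℂ V)
      (W : Type u) (_ : NormedAddCommGroup W) (_ : InnerProductSpace ℂ W)
      (_ : FiniteDimensional ℂ W) (J₁ : V →ₗᵢ[ℂ] HA) (J₂ : W →ₗᵢ[ℂ] HB) (x : V ⊗[ℂ] W),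
      TensorProduct.mapIsometry J₁ J₂ x = v := by
  obtain ⟨V, W, hV, hW, hv⟩ :=
    TensorProduct.exists_finite_submodule_of_setFinite {v} (Set.finite_singleton v)
  obtain ⟨x, hx⟩ := hv rfl
  exact ⟨V, inferInstance, inferInstance, hV, W, inferInstance, inferInstance, hW,
    V.subtypeₗᵢ, W.subtypeₗᵢ, x, hx⟩

theorem exists_isFiniteDimensionalValue_gt (h : ∀ z : MA ⊗[ℝ] MB, pminNorm z = pmaxNorm z)
    {ω : (MA ⊗[ℝ] MB) →ₗ[ℝ] ℝ} (hω : IsPmaxState ω) (z : MA ⊗[ℝ] MB) {δ : ℝ} (hδ : 0 < δ) :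
    ∃ t, ω z - δ < t ∧ IsFiniteDimensionalValue z t := by
  obtain ⟨HA, _, _, _, HB, _, _, _, TA, TB, v, hA, hB, hlt⟩ :=
    exists_lt_inner_algTensorMap h hω z hδ
  obtain ⟨V, _, _, _, W, _, _, _, J₁, J₂, x, rfl⟩ := exists_mapIsometry_eq v
  have : CompleteSpace V := FiniteDimensional.complete ℂ V
  have : CompleteSpace W := FiniteDimensional.complete ℂ W
  rw [← inner_algTensorMap_compression, LinearIsometry.norm_map] at hlt
  have hx : x ≠ 0 := by
    rintro rfl
    simp at hlt
  have hx2 : 0 < ‖x‖ ^ 2 := by positivity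
  set SA : MA →ₗ[ℝ] (V →L[ℂ] V) := (compression J₁ : OpMap HA V) ∘ₗ TA
  set SB : MB →ₗ[ℝ] (W →L[ℂ] W) := (compression J₂ : OpMap HB W) ∘ₗ TB
  have hSA : MA.IsRepresentation SA := hA.compression J₁
  have hSB : MB.IsRepresentation SB := hB.compression J₂
  have hs := isSymmetric_prodMap hSA.leftAmp hSB.rightAmp (commutingRanges_amp SA SB) z
  refine ⟨(‖x‖ ^ 2)⁻¹ * (inner ℂ (algTensorMap SA SB z x) x).re, ?_, V ⊗[ℂ] W, inferInstance,
    inferInstance, inferInstance, _, _, vectorState x, hSA.leftAmp, hSB.rightAmp,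
    commutingRanges_amp SA SB, isOperatorState_vectorState hx, ?_⟩
  · rwa [inv_mul_eq_div, lt_div_iff₀ hx2]
  · rw [vectorState_apply, Complex.ofReal_mul]
    congr 1
    refine (hs x x).symm.trans ?_
    exact (hs.coe_re_inner_apply_self x).symm

/-- The one-sided estimate for z and for −z yields values s > ω(z) − ε and −t < ω(z) + ε. Either one
of them is already close, or ω(z) lies between them and convexity attains it exactly. -/
theorem exists_isFiniteDimensionalValue_near (h : ∀ z : MA ⊗[ℝ] MB, pminNorm z = pmaxNorm z)
    {ω : (MA ⊗[ℝ] MB) →ₗ[ℝ] ℝ} (hω : IsPmaxState ω) (z : MA ⊗[ℝ] MB) {ε : ℝ} (hε : 0 < ε) :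
    ∃ t, |ω z - t| < ε ∧ IsFiniteDimensionalValue z t := by
  obtain ⟨s, hs, hsv⟩ := exists_isFiniteDimensionalValue_gt h hω z hε
  obtain ⟨t, ht, htv⟩ := exists_isFiniteDimensionalValue_gt h hω ((-1 : ℝ) • z) hε
  replace htv := htv.of_neg
  rw [map_smul, neg_one_smul] at ht
  rcases lt_or_ge s (ω z + ε) with h1 | h1
  · exact ⟨s, abs_lt.2 ⟨by linarith, by linarith⟩, hsv⟩
  rcases lt_or_ge (ω z - ε) (-t) with h2 | h2
  · exact ⟨-t, abs_lt.2 ⟨by linarith, by linarith⟩, htv⟩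
  have h3 : 0 < s - -t := by linarith
  -- The weight solving c·s + (1 − c)·(−t) = ω(z).
  refine ⟨_, ?_, hsv.convex htv (c := (ω z - -t) / (s - -t))
    (div_nonneg (by linarith) h3.le) ((div_le_one h3).2 (by linarith))⟩
  have h4 : (ω z - -t) / (s - -t) * s + (1 - (ω z - -t) / (s - -t)) * -t = ω z := by
    have h5 := h3.ne'
    field_simp
    ring
  rwa [h4, sub_self, abs_zero]

end Approximation

end OperatorSystem

theorem mainTheorem2 {KA KB : Type u}
    [NormedAddCommGroup KA] [InnerProductSpace ℂ KA] [CompleteSpace KA]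
    [NormedAddCommGroup KB] [InnerProductSpace ℂ KB] [CompleteSpace KB]
    (MA : OperatorSystem KA) (MB : OperatorSystem KB) :
    (∀ z : MA ⊗[ℝ] MB, OperatorSystem.pminNorm z = OperatorSystem.pmaxNorm z) ↔
    (∀ (z : MA ⊗[ℝ] MB) (ω : (MA ⊗[ℝ] MB) →ₗ[ℝ] ℝ), OperatorSystem.IsPmaxState ω →
      ∀ ε : ℝ, 0 < ε →
        ∃ (H : Type u) (_ : NormedAddCommGroup H) (_ : InnerProductSpace ℂ H)
          (_ : FiniteDimensional ℂ H)
          (TA : MA →ₗ[ℝ] (H →L[ℂ] H)) (TB : MB →ₗ[ℝ] (H →L[ℂ] H))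
          (φ : (H →L[ℂ] H) →ₗ[ℂ] ℂ),
          MA.IsRepresentation TA ∧ MB.IsRepresentation TB ∧
          OperatorSystem.CommutingRanges TA TB ∧ IsOperatorState φ ∧
          ‖(ω z : ℂ) - φ (OperatorSystem.prodMap TA TB z)‖ < ε) := by
  constructor
  · intro h z ω hω ε hε
    obtain ⟨t, ht, H, _, _, _, TA, TB, φ, hA, hB, hAB, hφ, hφt⟩ :=
      OperatorSystem.exists_isFiniteDimensionalValue_near h hω z hε
    refine ⟨H, _, _, ‹_›, TA, TB, φ, hA, hB, hAB, hφ, ?_⟩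
    rwa [hφt, ← Complex.ofReal_sub, Complex.norm_real, Real.norm_eq_abs]
  · intro h z
    exact le_antisymm (OperatorSystem.pminNorm_le_pmaxNorm z)
      (OperatorSystem.pmaxNorm_le_pminNorm_of_approx z (h z))
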